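/- Let $n\ge 1$ and let $\Phi^+\subset\mathbb R^n$ be the standard set of positive roots of type $B_n$, namely $\{e_i\}_{1\le i\le n}\cup\{e_i\pm e_j\}_{1\le i<j\le n}$, or of type $C_n$, namely $\{2e_i\}_{1\le i\le n}\cup\{e_i\pm e_j\}_{1\le i<j\le n}$. Let $\Phi^-=-\Phi^+$ and let $W$ be the Weyl group, generated by the reflections in the hyperplanes $\alpha^\perp$, $\alpha\in\Phi^+$. For $w\in W$ put $N(w)=\Phi^+\cap w(\Phi^-)$, and let $C_w=w(C_e)$ be the Weyl cone of $w$, where $C_e=\{x:\langle\alpha,x\rangle>0\text{ for all }\alpha\in\Phi^+\}$. The Shi arrangement consists of the hyperplanes $\langle\alpha,x\rangle=0$ and $\langle\alpha,x\rangle=1$ for $\alpha\in\Phi^+$; its regions are the connected components of its complement, and $|C_w|$ denotes the number of those regions that lie in $C_w$. Let $\alpha_1,\dots,\alpha_n$ be the simple roots: $\alpha_i=e_i-e_{i+1}$ for $i<n$, and $\alpha_n=e_n$ in type $B_n$, $\alpha_n=2e_n$ in type $C_n$. Write $\alpha_{ij}=\alpha_i+\dots+\alpha_j$. Consider the diagram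 of boxes $(i,j)$ ("the $i$-th box in row $j$") with $1\le j\le 2n-1$ and $1\le i\le\min(j,2n-j)$. The box $(i,j)$ is labelled by the root $\alpha_{ij}$ if $j\le n$; if $j>n$ it is labelled by $\alpha_{in}+\alpha_{kn}$ with $k=2n-j+1$ in type $B_n$, and by $\alpha_{in}+\alpha_{k,n-1}$ with $k=2n-j$ in type $C_n$. The labels are exactly the positive roots. The bottom left and top right vertices of the box $(i,j)$ are $v^{bl}=(i-1,j)$ and $v^{tr}=(i,j+1)$ (the initial and the final point of its corner, the path $(i-1,j)\to(i,j)\to(i,j+1)$). For $A,B\in\mathbb Z^2$ let $\hat\gamma(A\to B)$ be the number of lattice paths from $A$ to $B$ with unit north and east steps all of whose vertices lie weakly above the line $x=y$. Let $I=(0,1)$, $F=(1,2n)$, $F^{D_i}=(i,2n-i)$ for $0\le i\le n$, and define the diagonal sum $$\gamma^{D\Sigma}\big((a,b)\to F\big)=\begin{cases}\sum_{i=0}^{n}\hat\gamma\big((a,b)\to F^{D_i}\big)&\text{if } b\ne 2n-a+1,\\ 1&\text{if } b=2n-a+1.\end{cases}$$ Let $w\in W$ and let $N(w^{-1})=\{\beta_1,\dots,\beta_k\}$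 with $\beta_1,\dots,\beta_k$ distinct, where $\beta_\ell$ is the label of the box $(i_\ell,j_\ell)$, with vertices $v^{bl}_\ell=(i_\ell-1,j_\ell)$ and $v^{tr}_\ell=(i_\ell,j_\ell+1)$. Then $$|C_w|=\det\begin{pmatrix} 1&\hat\gamma(v^{tr}_2\to v^{bl}_1)&\cdots&\hat\gamma(v^{tr}_k\to v^{bl}_1)&\hat\gamma(I\to v^{bl}_1)\\ \hat\gamma(v^{tr}_1\to v^{bl}_2)&1&\cdots&\hat\gamma(v^{tr}_k\to v^{bl}_2)&\hat\gamma(I\to v^{bl}_2)\\ \vdots&\vdots&\ddots&\vdots&\vdots\\ \hat\gamma(v^{tr}_1\to v^{bl}_k)&\hat\gamma(v^{tr}_2\to v^{bl}_k)&\cdots&1&\hat\gamma(I\to v^{bl}_k)\\ \gamma^{D\Sigma}(v^{tr}_1\to F)&\gamma^{D\Sigma}(v^{tr}_2\to F)&\cdots&\gamma^{D\Sigma}(v^{tr}_k\to F)&\gamma^{D\Sigma}(I\to F) \end{pmatrix}.$$ -/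

import Mathlib

open scoped InnerProductSpace

noncomputable section

namespace ShiCone

/-! ### Inversion sets, Weyl cones and Shi regions of a set of positive roots -/

section Arrangement

variable {V : Type*} [NormedAddCommGroup V] [InnerProductSpace ℝ V] [FiniteDimensional ℝ V]

/-- The Weyl group of the root system with positive roots `P`: the group of linear isometries
generated by the orthogonal reflections in the hyperplanes `α^⊥`, for `α ∈ P`. -/
def weylGroup (P : Set V) : Subgroup (V ≃ₗᵢ[ℝ] V) :=
  Subgroup.closure {s | ∃ α ∈ P, s = (ℝ ∙ α)ᗮ.reflection}

/-- The inversion set `N(w) = Φ⁺ ∩ w(Φ⁻)`, where `Φ⁻ = -Φ⁺`. -/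
def inversionSet (P : Set V) (w : V ≃ₗᵢ[ℝ] V) : Set V :=
  {β | β ∈ P ∧ ∃ α ∈ P, w (-α) = β}

/-- The dominant cone `C_e`. -/
def dominantCone (P : Set V) : Set V :=
  {x | ∀ α ∈ P, 0 < ⟪α, x⟫_ℝ}

/-- The Weyl cone `C_w = w(C_e)`. -/
def weylCone (P : Set V) (w : V ≃ₗᵢ[ℝ] V) : Set V :=
  w '' dominantCone P

/-- The complement of the Shi arrangement, whose hyperplanes are `⟪α, x⟫ = 0` and `⟪α, x⟫ = 1`
for `α ∈ Φ⁺`. -/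
def shiComplement (P : Set V) : Set V :=
  {x | ∀ α ∈ P, ⟪α, x⟫_ℝ ≠ 0 ∧ ⟪α, x⟫_ℝ ≠ 1}

/-- The regions of the Shi arrangement: the connected components of its complement. -/
def shiRegions (P : Set V) : Set (Set V) :=
  {R | ∃ x ∈ shiComplement P, R = connectedComponentIn (shiComplement P) x}

/-- The number of regions of the Shi arrangement in the Weyl cone `C_w`. -/
def numRegions (P : Set V) (w : V ≃ₗᵢ[ℝ] V) : ℕ :=
  {R | R ∈ shiRegions P ∧ R ⊆ weylCone P w}.ncard

end Arrangement

/-! ### The root systems of types `B_n` and `C_n` -/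

/-- The standard basis vector `e_i` of `ℝⁿ` for `1 ≤ i ≤ n` (and `0` for other `i`). -/
def basisVec (n i : ℕ) : EuclideanSpace ℝ (Fin n) :=
  WithLp.toLp 2 fun m => if (m : ℕ) + 1 = i then 1 else 0

/-- The positive roots of type `B_n`: `e_i` for all `i` and `e_i ± e_j` for `i < j`. -/
def posRootsB (n : ℕ) : Set (EuclideanSpace ℝ (Fin n)) :=
  {v | (∃ i, 1 ≤ i ∧ i ≤ n ∧ v = basisVec n i) ∨
    ∃ i j, 1 ≤ i ∧ i < j ∧ j ≤ n ∧
      (v = basisVec n i - basisVec n j ∨ v = basisVec n i + basisVec n j)}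

/-- The positive roots of type `C_n`: `2e_i` for all `i` and `e_i ± e_j` for `i < j`. -/
def posRootsC (n : ℕ) : Set (EuclideanSpace ℝ (Fin n)) :=
  {v | (∃ i, 1 ≤ i ∧ i ≤ n ∧ v = (2 : ℝ) • basisVec n i) ∨
    ∃ i j, 1 ≤ i ∧ i < j ∧ j ≤ n ∧
      (v = basisVec n i - basisVec n j ∨ v = basisVec n i + basisVec n j)}

/-- The simple roots `α_i` (`1 ≤ i ≤ n`) of type `B_n`. -/
def simpleRootB (n i : ℕ) : EuclideanSpace ℝ (Fin n) :=
  if i < n then basisVec n i - basisVec n (i + 1) else basisVec n i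

/-- The simple roots `α_i` (`1 ≤ i ≤ n`) of type `C_n`. -/
def simpleRootC (n i : ℕ) : EuclideanSpace ℝ (Fin n) :=
  if i < n then basisVec n i - basisVec n (i + 1) else (2 : ℝ) • basisVec n i

/-- `α_{ij} = α_i + ⋯ + α_j`. -/
def rootSum {V : Type*} [AddCommGroup V] (α : ℕ → V) (i j : ℕ) : V :=
  ∑ m ∈ Finset.Icc i j, α m

/-! ### The diagram of boxes and its labels -/

/-- The diagram with rows `j = 1, …, 2n - 1` (from bottom to top), row `j` consisting of
the boxes `i = 1, …, min (j, 2n - j)`. The pair `(i, j)` is the `i`-th box in row `j`. -/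
def diagram (n : ℕ) : Set (ℕ × ℕ) :=
  {c | 1 ≤ c.1 ∧ c.1 ≤ c.2 ∧ c.1 + c.2 ≤ 2 * n}

/-- The root of type `B_n` labelling the box `(i, j)`: it is `α_{ij}` if `j ≤ n` and
`α_{in} + α_{kn}` with `k = 2n - j + 1` if `j > n`. -/
def boxRootB (n : ℕ) (c : ℕ × ℕ) : EuclideanSpace ℝ (Fin n) :=
  if c.2 ≤ n then rootSum (simpleRootB n) c.1 c.2
  else rootSum (simpleRootB n) c.1 n + rootSum (simpleRootB n) (2 * n - c.2 + 1) n

/-- The root of type `C_n` labelling the box `(i, j)`: it is `α_{ij}` if `j ≤ n` and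
`α_{in} + α_{k,n-1}` with `k = 2n - j` if `j > n`. -/
def boxRootC (n : ℕ) (c : ℕ × ℕ) : EuclideanSpace ℝ (Fin n) :=
  if c.2 ≤ n then rootSum (simpleRootC n) c.1 c.2
  else rootSum (simpleRootC n) c.1 n + rootSum (simpleRootC n) (2 * n - c.2) (n - 1)

/-- The bottom left vertex `v^{bl} = (i - 1, j)` of the box `(i, j)`, which is the initial point of
the corner `v^{bl} → v^{br} → v^{tr}` of the box. -/
def vbl (c : ℕ × ℕ) : ℤ × ℤ := ((c.1 : ℤ) - 1, (c.2 : ℤ))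

/-- The top right vertex `v^{tr} = (i, j + 1)` of the box `(i, j)`, which is the final point of
the corner of the box. -/
def vtr (c : ℕ × ℕ) : ℤ × ℤ := ((c.1 : ℤ), (c.2 : ℤ) + 1)

/-! ### Lattice paths and the determinant -/

/-- A unit step to the north or to the east in `ℤ²`. -/
def IsStep (p q : ℤ × ℤ) : Prop := q = (p.1, p.2 + 1) ∨ q = (p.1 + 1, p.2)

/-- The lattice paths (given by their lists of vertices) from `A` to `B` with unit steps to the
north and to the east, all of whose vertices are weakly above the line `x = y`. -/
def pathsAbove (A B : ℤ × ℤ) : Set (List (ℤ × ℤ)) :=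
  {l | l.IsChain IsStep ∧ l.head? = some A ∧ l.getLast? = some B ∧ ∀ p ∈ l, p.1 ≤ p.2}

/-- The number of lattice paths from `A` to `B` weakly above the line `x = y`. -/
def gammaAbove (A B : ℤ × ℤ) : ℤ := ((pathsAbove A B).ncard : ℤ)

/-- The diagonal sum: for `X = (a, b)` it is the sum over `i = 0, …, n` of the numbers of lattice
paths weakly above `x = y` from `X` to `F^{D_i} = (i, 2n - i)` if `b ≠ 2n - a + 1`,
and `1` if `b = 2n - a + 1`. -/
def diagonalSum (n : ℕ) (X : ℤ × ℤ) : ℤ :=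
  if X.2 = 2 * (n : ℤ) - X.1 + 1 then 1
  else ∑ i ∈ Finset.range (n + 1), gammaAbove X ((i : ℤ), 2 * (n : ℤ) - (i : ℤ))

/-- The `(k + 1) × (k + 1)` matrix attached to the boxes `c_1, …, c_k`; the point of `Unit` indexes
the last row and the last column, and `I = (0, 1)`. -/
def cornerMatrix (n : ℕ) {k : ℕ} (c : Fin k → ℕ × ℕ) : Matrix (Fin k ⊕ Unit) (Fin k ⊕ Unit) ℤ :=
  Matrix.fromBlocks
    (Matrix.of fun a b => if a = b then 1 else gammaAbove (vtr (c b)) (vbl (c a)))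
    (Matrix.of fun a _ => gammaAbove (0, 1) (vbl (c a)))
    (Matrix.of fun _ b => diagonalSum n (vtr (c b)))
    (Matrix.of fun _ _ => diagonalSum n (0, 1))


/-! ### The labels of the boxes are exactly the positive roots -/

theorem basisVec_apply (n i : ℕ) (m : Fin n) :
    basisVec n i m = if (m : ℕ) + 1 = i then 1 else 0 := rfl

theorem basisVec_succ_self (n : ℕ) : basisVec n (n + 1) = 0 := by
  ext m
  simp [basisVec_apply, m.isLt.ne]

theorem rootSum_succ {V : Type*} [AddCommGroup V] (α : ℕ → V) {i j : ℕ} (h : i ≤ j + 1) :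
    rootSum α i (j + 1) = rootSum α i j + α (j + 1) := by
  unfold rootSum
  exact Finset.sum_Icc_succ_top h α

theorem rootSum_of_lt {n : ℕ} {α : ℕ → EuclideanSpace ℝ (Fin n)}
    (hα : ∀ i, i < n → α i = basisVec n i - basisVec n (i + 1)) {i j : ℕ} (hij : i ≤ j)
    (hj : j < n) : rootSum α i j = basisVec n i - basisVec n (j + 1) := by
  induction j, hij using Nat.le_induction with
  | base => simp [rootSum, hα i hj]
  | succ j hij ih =>
    rw [rootSum_succ _ (by omega), ih (by omega), hα _ hj]
    abel

theorem rootSumB_lt {n i j : ℕ} (hij : i ≤ j) (hj : j < n) :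
    rootSum (simpleRootB n) i j = basisVec n i - basisVec n (j + 1) :=
  rootSum_of_lt (fun i hi => by simp [simpleRootB, hi]) hij hj

theorem rootSumC_lt {n i j : ℕ} (hij : i ≤ j) (hj : j < n) :
    rootSum (simpleRootC n) i j = basisVec n i - basisVec n (j + 1) :=
  rootSum_of_lt (fun i hi => by simp [simpleRootC, hi]) hij hj

theorem rootSumB_top {n i : ℕ} (hi : 1 ≤ i) (hin : i ≤ n) :
    rootSum (simpleRootB n) i n = basisVec n i := by
  rcases hin.eq_or_lt with rfl | h
  · simp [rootSum, simpleRootB]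
  · obtain ⟨m, rfl⟩ : ∃ m, n = m + 1 := ⟨n - 1, by omega⟩
    rw [rootSum_succ _ hin, rootSumB_lt (by omega) (by omega)]
    simp [simpleRootB]

theorem rootSumC_top {n i : ℕ} (hi : 1 ≤ i) (hin : i ≤ n) :
    rootSum (simpleRootC n) i n = basisVec n i + basisVec n n := by
  rcases hin.eq_or_lt with rfl | h
  · simp [rootSum, simpleRootC, two_smul]
  · obtain ⟨m, rfl⟩ : ∃ m, n = m + 1 := ⟨n - 1, by omega⟩
    rw [rootSum_succ _ hin, rootSumC_lt (by omega) (by omega)]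
    simp [simpleRootC, two_smul]

theorem boxRootB_eq {n : ℕ} {c : ℕ × ℕ} (hc : c ∈ diagram n) : boxRootB n c =
    if c.2 ≤ n then basisVec n c.1 - basisVec n (c.2 + 1)
    else basisVec n c.1 + basisVec n (2 * n - c.2 + 1) := by
  obtain ⟨h1, h2, h3⟩ := hc
  unfold boxRootB
  split_ifs with h
  · rcases h.eq_or_lt with h' | h'
    · rw [h', rootSumB_top h1 (by omega), basisVec_succ_self, sub_zero]
    · rw [rootSumB_lt h2 h']
  · rw [rootSumB_top h1 (by omega), rootSumB_top (by omega) (by omega)]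

theorem boxRootC_eq {n : ℕ} {c : ℕ × ℕ} (hc : c ∈ diagram n) : boxRootC n c =
    if c.2 < n then basisVec n c.1 - basisVec n (c.2 + 1)
    else basisVec n c.1 + basisVec n (2 * n - c.2) := by
  obtain ⟨h1, h2, h3⟩ := hc
  unfold boxRootC
  rcases lt_trichotomy c.2 n with h | h | h
  · rw [if_pos h.le, if_pos h, rootSumC_lt h2 h]
  · rw [if_pos h.le, if_neg (by omega), h, rootSumC_top h1 (by omega), two_mul,
      Nat.add_sub_cancel]
  · rw [if_neg (by omega), if_neg (by omega), rootSumC_top h1 (by omega),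
      rootSumC_lt (by omega) (by omega), Nat.sub_add_cancel (by omega)]
    abel

/-- The labels of the boxes in type `B_n` are exactly the positive roots. -/
theorem boxRootB_image (n : ℕ) : boxRootB n '' diagram n = posRootsB n := by
  ext v
  constructor
  · rintro ⟨c, hc, rfl⟩
    rw [boxRootB_eq hc]
    obtain ⟨h1, h2, h3⟩ := hc
    split_ifs with h
    · rcases h.eq_or_lt with h' | h'
      · left
        exact ⟨c.1, h1, by omega, by rw [h', basisVec_succ_self, sub_zero]⟩
      · right
        exact ⟨c.1, c.2 + 1, h1, by omega, by omega, Or.inl rfl⟩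
    · right
      exact ⟨c.1, 2 * n - c.2 + 1, h1, by omega, by omega, Or.inr rfl⟩
  · rintro (⟨i, h1, h2, rfl⟩ | ⟨i, j, h1, h2, h3, rfl | rfl⟩)
    · have hc : (i, n) ∈ diagram n := ⟨h1, h2, by simp only; omega⟩
      refine ⟨(i, n), hc, ?_⟩
      rw [boxRootB_eq hc, if_pos le_rfl, basisVec_succ_self, sub_zero]
    · have hc : (i, j - 1) ∈ diagram n := ⟨h1, by simp only; omega, by simp only; omega⟩
      refine ⟨(i, j - 1), hc, ?_⟩
      rw [boxRootB_eq hc, if_pos (by simp only; omega)]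
      simp only
      rw [Nat.sub_add_cancel (by omega)]
    · have hc : (i, 2 * n + 1 - j) ∈ diagram n := ⟨h1, by simp only; omega, by simp only; omega⟩
      refine ⟨(i, 2 * n + 1 - j), hc, ?_⟩
      rw [boxRootB_eq hc, if_neg (by simp only; omega)]
      simp only
      rw [show 2 * n - (2 * n + 1 - j) + 1 = j by omega]

/-- The labels of the boxes in type `C_n` are exactly the positive roots. -/
theorem boxRootC_image (n : ℕ) : boxRootC n '' diagram n = posRootsC n := by
  ext v
  constructor
  · rintro ⟨c, hc, rfl⟩
    rw [boxRootC_eq hc]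
    obtain ⟨h1, h2, h3⟩ := hc
    split_ifs with h
    · right
      exact ⟨c.1, c.2 + 1, h1, by omega, by omega, Or.inl rfl⟩
    · rcases h3.eq_or_lt with h' | h'
      · left
        exact ⟨c.1, h1, by omega, by rw [show 2 * n - c.2 = c.1 by omega, two_smul]⟩
      · right
        exact ⟨c.1, 2 * n - c.2, h1, by omega, by omega, Or.inr rfl⟩
  · rintro (⟨i, h1, h2, rfl⟩ | ⟨i, j, h1, h2, h3, rfl | rfl⟩)
    · have hc : (i, 2 * n - i) ∈ diagram n := ⟨h1, by simp only; omega, by simp only; omega⟩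
      refine ⟨(i, 2 * n - i), hc, ?_⟩
      rw [boxRootC_eq hc, if_neg (by simp only; omega)]
      simp only
      rw [show 2 * n - (2 * n - i) = i by omega, two_smul]
    · have hc : (i, j - 1) ∈ diagram n := ⟨h1, by simp only; omega, by simp only; omega⟩
      refine ⟨(i, j - 1), hc, ?_⟩
      rw [boxRootC_eq hc, if_pos (by simp only; omega)]
      simp only
      rw [Nat.sub_add_cancel (by omega)]
    · have hc : (i, 2 * n - j) ∈ diagram n := ⟨h1, by simp only; omega, by simp only; omega⟩
      refine ⟨(i, 2 * n - j), hc, ?_⟩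
      rw [boxRootC_eq hc, if_neg (by simp only; omega)]
      simp only
      rw [show 2 * n - (2 * n - j) = j by omega]

end ShiCone

end

open scoped InnerProductSpace

noncomputable section

namespace ShiCone

/-! ### Lattice paths -/

/-! Both sides count the antichains of positive roots that avoid `N(w⁻¹)`.

Geometry: write a point of `C_w` as `w y` with `y` dominant. Only the hyperplanes at height 1 of
roots `w β`, where `β` and `w β` are both positive, can cut `C_w`, and these `β` are the roots
outside `N(w⁻¹)`. The region of `w y` is thus determined by the set of such `β` with `⟪β, y⟫ > 1`.
On the dominant cone `⟪β, y⟫` is monotone in the root order, so this set is determined by its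
minimal elements, an antichain. Conversely, every order filter of positive roots is cut out by
height 1 at some dominant point (`exists_mem_dominantCone`). In the diagram, going up in the root
order is going weakly north-west, so antichains of roots are chains for `NE`. This gives
`numRegions_eq_card_chains`.

Combinatorics: a path is determined by its east-north corners, which form an `NE`-chain of boxes.
Let `h x` be the number of chains beyond `x` avoiding the forbidden boxes `N`. Sorting all paths by
their last forbidden corner gives `diagonalSum (vtr x) = h x + ∑ a ∈ N, h a * gammaAbove (vtr x)
(vbl a)` (`diagonalSum_vtr_eq_numChains`), proved from the first-corner recursions of all three
quantities. Hence subtracting `h a` times row `a` from the last row of the matrix leaves only its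
last entry, the number of all admissible chains, and the remaining block has determinant 1
(`det_cornerMatrix`).

The two types are treated together through the sequence `symVec`, which folds a type `A` root system
onto `B_n` or `C_n`. -/

theorem le_of_mem_pathsAbove {A B : ℤ × ℤ} {l : List (ℤ × ℤ)} (h : l ∈ pathsAbove A B) :
    A.1 ≤ B.1 ∧ A.2 ≤ B.2 := by
  obtain ⟨hc, hh, hl, -⟩ := h
  induction l generalizing A with
  | nil => simp at hh
  | cons a t ih =>
    obtain rfl : a = A := by simpa using hh
    cases t with
    | nil => obtain rfl : a = B := by simpa using hl
             exact ⟨le_rfl, le_rfl⟩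
    | cons b t =>
      rw [List.isChain_cons_cons] at hc
      have := ih (A := b) hc.2 rfl (by simpa using hl)
      rcases hc.1 with h | h <;> subst h <;> simp only at this <;> constructor <;> omega

theorem pathsAbove_self {A : ℤ × ℤ} (hA : A.1 ≤ A.2) : pathsAbove A A = {[A]} := by
  ext l
  constructor
  · rintro ⟨hc, hh, hl, hp⟩
    cases l with
    | nil => simp at hh
    | cons a t =>
      obtain rfl : a = A := by simpa using hh
      cases t with
      | nil => rfl
      | cons b t =>
        rw [List.isChain_cons_cons] at hc
        have := le_of_mem_pathsAbove (A := b) (B := a) (l := b :: t)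
          ⟨hc.2, rfl, by simpa using hl, fun p hp' => hp p (by simp_all)⟩
        rcases hc.1 with h | h <;> subst h <;> simp only at this <;> omega
  · rintro rfl
    exact ⟨by simp, rfl, rfl, by simpa using hA⟩

theorem pathsAbove_of_lt {A B : ℤ × ℤ} (h : A.2 < A.1) : pathsAbove A B = ∅ := by
  ext l
  simp only [Set.mem_empty_iff_false, iff_false]
  rintro ⟨-, hh, -, hp⟩
  have := hp A (List.mem_of_mem_head? hh)
  omega

theorem pathsAbove_cons {A B : ℤ × ℤ} (hA : A.1 ≤ A.2) (hAB : A ≠ B) :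
    pathsAbove A B = List.cons A '' (pathsAbove (A.1, A.2 + 1) B ∪ pathsAbove (A.1 + 1, A.2) B) := by
  ext l
  constructor
  · rintro ⟨hc, hh, hl, hp⟩
    cases l with
    | nil => simp at hh
    | cons a t =>
      obtain rfl : a = A := by simpa using hh
      cases t with
      | nil => exact absurd (by simpa using hl) hAB
      | cons b t =>
        rw [List.isChain_cons_cons] at hc
        refine ⟨b :: t, ?_, rfl⟩
        have hl' : (b :: t).getLast? = some B := by simpa using hl
        have hp' : ∀ p ∈ b :: t, p.1 ≤ p.2 := fun p hq => hp p (List.mem_cons_of_mem _ hq)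
        rcases hc.1 with h | h
        · left; exact ⟨hc.2, by rw [← h]; rfl, hl', hp'⟩
        · right; exact ⟨hc.2, by rw [← h]; rfl, hl', hp'⟩
  · rintro ⟨t, ht, rfl⟩
    have key : ∀ A', IsStep A A' → t ∈ pathsAbove A' B → A :: t ∈ pathsAbove A B := by
      rintro A' hs ⟨hc, hh, hl, hp⟩
      cases t with
      | nil => simp at hh
      | cons b t =>
        obtain rfl : b = A' := by simpa using hh
        refine ⟨List.isChain_cons_cons.2 ⟨hs, hc⟩, rfl, by simpa using hl, ?_⟩
        intro p hq
        rcases List.mem_cons.1 hq with rfl | hq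
        · exact hA
        · exact hp p hq
    rcases ht with ht | ht
    · exact key _ (Or.inl rfl) ht
    · exact key _ (Or.inr rfl) ht

theorem finite_pathsAbove (A B : ℤ × ℤ) : (pathsAbove A B).Finite := by
  -- Each step raises the coordinate sum by one, so the induction is on a bound for the number of
  -- remaining steps.
  obtain ⟨m, hm⟩ : ∃ m : ℕ, B.1 + B.2 - (A.1 + A.2) < m :=
    ⟨(B.1 + B.2 - (A.1 + A.2) + 1).toNat, by omega⟩
  induction m generalizing A with
  | zero =>
    convert Set.finite_empty
    ext l
    simp only [Set.mem_empty_iff_false, iff_false]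
    intro hl
    have := le_of_mem_pathsAbove hl
    push_cast at hm
    omega
  | succ m ih =>
    by_cases hA : A.1 ≤ A.2
    · by_cases hAB : A = B
      · subst hAB
        rw [pathsAbove_self hA]
        exact Set.finite_singleton _
      · rw [pathsAbove_cons hA hAB]
        push_cast at hm
        exact ((ih _ (by simp only; omega)).union (ih _ (by simp only; omega))).image _
    · rw [pathsAbove_of_lt (by omega)]
      exact Set.finite_empty

theorem gammaAbove_self {A : ℤ × ℤ} (hA : A.1 ≤ A.2) : gammaAbove A A = 1 := by
  simp [gammaAbove, pathsAbove_self hA]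

theorem gammaAbove_of_lt {A B : ℤ × ℤ} (h : A.2 < A.1) : gammaAbove A B = 0 := by
  simp [gammaAbove, pathsAbove_of_lt h]

theorem gammaAbove_of_not_le {A B : ℤ × ℤ} (h : ¬(A.1 ≤ B.1 ∧ A.2 ≤ B.2)) :
    gammaAbove A B = 0 := by
  have : pathsAbove A B = ∅ := by
    ext l
    simp only [Set.mem_empty_iff_false, iff_false]
    exact fun hl => h (le_of_mem_pathsAbove hl)
  simp [gammaAbove, this]

theorem gammaAbove_cons {A B : ℤ × ℤ} (hA : A.1 ≤ A.2) (hAB : A ≠ B) :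
    gammaAbove A B = gammaAbove (A.1, A.2 + 1) B + gammaAbove (A.1 + 1, A.2) B := by
  unfold gammaAbove
  rw [pathsAbove_cons hA hAB, Set.ncard_image_of_injective _ (List.cons_injective),
    Set.ncard_union_eq _ (finite_pathsAbove _ _) (finite_pathsAbove _ _)]
  · push_cast; rfl
  · rw [Set.disjoint_left]
    rintro l ⟨-, h1, -⟩ ⟨-, h2, -⟩
    rw [h1] at h2
    simp at h2

/-! ### Expansions along the first corner -/

/-- Summation of a path recursion along the first east-north corner. -/
theorem eq_one_add_sum_corners (D : Finset (ℕ × ℕ)) (g : ℕ → ℕ → ℤ) (X : ℕ) (t : ℕ → ℕ)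
    (hD : ∀ i y, (i, y) ∈ D → i ≤ X ∧ i ≤ y)
    (hrow : ∀ x i y, (i, y) ∈ D → x < i → (x + 1, y) ∈ D)
    (htop : ∀ x i y, (i, y) ∈ D → x ≤ i → y < t x)
    (hbase : ∀ x ≤ X, x ≤ t x → g x (t x) = 1)
    (hrec : ∀ x y, x ≤ y → (x + 1, y) ∈ D → g x y = g x (y + 1) + g (x + 1) y)
    (hrec' : ∀ x y, x ≤ X → x ≤ y → y < t x → (x + 1, y) ∉ D → g x y = g x (y + 1))
    (x y : ℕ) (hx : x ≤ X) (hxy : x ≤ y) (hy : y ≤ t x) :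
    g x y = 1 + ∑ z ∈ D with x < z.1 ∧ y ≤ z.2, g z.1 (z.2 + 1) := by
  -- Follow the initial run of east steps in row `y`: it is empty, or it ends in a column `i` with a
  -- corner at `(i, y)`, after which the path restarts at `(i, y + 1)`.
  have row : ∀ m x y, X - x = m → x ≤ X → x ≤ y → y < t x →
      g x y = g x (y + 1) + ∑ z ∈ D with x < z.1 ∧ y = z.2, g z.1 (z.2 + 1) := by
    intro m
    induction m with
    | zero =>
      intro x y hm hx hxy hy
      rw [hrec' x y hx hxy hy (fun h => by have := hD _ _ h; omega), Finset.sum_eq_zero, add_zero]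
      rintro ⟨i, j⟩ hz
      rw [Finset.mem_filter] at hz
      have := hD _ _ hz.1
      simp only at hz
      omega
    | succ m ih =>
      intro x y hm hx hxy hy
      by_cases h : (x + 1, y) ∈ D
      · have hd := hD _ _ h
        have hs : {z ∈ D | x < z.1 ∧ y = z.2}
            = insert (x + 1, y) {z ∈ D | x + 1 < z.1 ∧ y = z.2} := by
          ext ⟨i, j⟩
          simp only [Finset.mem_filter, Finset.mem_insert, Prod.mk.injEq]
          constructor
          · rintro ⟨h1, h2, rfl⟩
            by_cases hi : i = x + 1
            · exact Or.inl ⟨hi, rfl⟩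
            · exact Or.inr ⟨h1, by omega, rfl⟩
          · rintro (⟨rfl, rfl⟩ | ⟨h1, h2, rfl⟩)
            · exact ⟨h, by omega, rfl⟩
            · exact ⟨h1, by omega, rfl⟩
        rw [hs, Finset.sum_insert (by simp), hrec x y hxy h]
        rw [ih (x + 1) y (by omega) hd.1 hd.2 (htop _ _ _ h le_rfl)]
      · rw [hrec' x y hx hxy hy h, Finset.sum_eq_zero, add_zero]
        rintro ⟨i, j⟩ hz
        rw [Finset.mem_filter] at hz
        obtain ⟨h1, h2, rfl⟩ := hz
        exact absurd (hrow _ _ _ h1 h2) h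
  obtain ⟨m, hm⟩ : ∃ m, t x - y = m := ⟨_, rfl⟩
  induction m generalizing y with
  | zero =>
    have : y = t x := by omega
    subst this
    rw [hbase x hx hxy, Finset.sum_eq_zero, add_zero]
    rintro ⟨i, j⟩ hz
    rw [Finset.mem_filter] at hz
    have := htop _ _ _ hz.1 hz.2.1.le
    simp only at hz
    omega
  | succ m ih =>
    rw [row _ x y rfl hx hxy (by omega), ih (y + 1) (by omega) (by omega) (by omega), add_assoc,
      ← Finset.sum_union]
    · congr 2
      ext z
      simp only [Finset.mem_union, Finset.mem_filter]
      grind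
    · rw [Finset.disjoint_left]
      intro z
      simp only [Finset.mem_filter]
      rintro ⟨-, -, h1⟩ ⟨-, -, h2⟩
      omega

/-- The boxes of the diagram, as a finite set. -/
def boxes (n : ℕ) : Finset (ℕ × ℕ) :=
  {z ∈ Finset.range (2 * n + 1) ×ˢ Finset.range (2 * n + 1) | 1 ≤ z.1 ∧ z.1 ≤ z.2 ∧ z.1 + z.2 ≤ 2 * n}

theorem mem_boxes {n : ℕ} {z : ℕ × ℕ} :
    z ∈ boxes n ↔ 1 ≤ z.1 ∧ z.1 ≤ z.2 ∧ z.1 + z.2 ≤ 2 * n := by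
  simp only [boxes, Finset.mem_filter, Finset.mem_product, Finset.mem_range,
    and_iff_right_iff_imp]
  omega

theorem mem_boxes_iff {n : ℕ} {z : ℕ × ℕ} : z ∈ boxes n ↔ z ∈ diagram n := mem_boxes

/-- The box `b` lies strictly to the north-east of the box `a`. -/
def NE (a b : ℕ × ℕ) : Prop := a.1 < b.1 ∧ a.2 < b.2

instance : DecidableRel NE := fun _ _ => inferInstanceAs (Decidable (_ ∧ _))

theorem NE.trans {a b c : ℕ × ℕ} (h : NE a b) (h' : NE b c) : NE a c :=
  ⟨h.1.trans h'.1, h.2.trans h'.2⟩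

theorem gammaAbove_vtr_vbl_eq_zero {a b : ℕ × ℕ} (h : ¬ NE b a) :
    gammaAbove (vtr b) (vbl a) = 0 := by
  apply gammaAbove_of_not_le
  unfold NE at h
  simp only [vtr, vbl]
  omega

/-- Expansion of the number of paths between two boxes along the first corner. -/
theorem gammaAbove_vtr_vbl {n : ℕ} {a b : ℕ × ℕ} (hb : b.1 ≤ b.2) (ha : a ∈ boxes n)
    (h : NE b a) : gammaAbove (vtr b) (vbl a) =
      1 + ∑ z ∈ boxes n with NE b z, if NE z a then gammaAbove (vtr z) (vbl a) else 0 := by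
  rw [mem_boxes] at ha
  -- The last column is `a.1 - 1` and every column ends in row `a.2`: once in that row, a path can
  -- only run east to `vbl a` and makes no further corner.
  have := eq_one_add_sum_corners {z ∈ boxes n | NE z a}
    (fun x y => gammaAbove ((x : ℤ), (y : ℤ)) (vbl a)) (a.1 - 1) (fun _ => a.2)
    ?_ ?_ ?_ ?_ ?_ ?_ b.1 (b.2 + 1) ?_ ?_ ?_
  · simp only [vtr]
    push_cast at this
    rw [this, Finset.filter_filter, ← Finset.sum_filter, Finset.filter_filter]
    congr 1
    refine Finset.sum_congr ?_ fun _ _ => rfl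
    ext z
    simp only [NE]
    grind
  · intro i y hz
    rw [Finset.mem_filter, mem_boxes] at hz
    simp only [NE] at hz
    omega
  · intro x i y hz
    rw [Finset.mem_filter, mem_boxes] at hz ⊢
    simp only [NE] at hz ⊢
    omega
  · intro x i y hz
    rw [Finset.mem_filter, mem_boxes] at hz
    simp only [NE] at hz ⊢
    omega
  · intro x hx hxt
    obtain ⟨d, hd⟩ : ∃ d, a.1 - 1 - x = d := ⟨_, rfl⟩
    induction d generalizing x with
    | zero =>
      have : ((x : ℤ), (a.2 : ℤ)) = vbl a := Prod.ext (by simp only [vbl]; omega) rfl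
      rw [this]
      exact gammaAbove_self (by simp only [vbl]; omega)
    | succ d ih =>
      rw [gammaAbove_cons (by simp only; omega)
        (by simp only [vbl, ne_eq, Prod.mk.injEq]; omega),
        gammaAbove_of_not_le (A := ((x : ℤ), (a.2 : ℤ) + 1)) (by simp only [vbl]; omega), zero_add]
      exact_mod_cast ih (x + 1) (by omega) (by omega) (by omega)
  · intro x y hxy hz
    rw [Finset.mem_filter, mem_boxes] at hz
    simp only [NE] at hz
    rw [gammaAbove_cons (by simp only; omega)
        (by simp only [vbl, ne_eq, Prod.mk.injEq]; omega)]
    push_cast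
    rfl
  · intro x y hx hxy hy hz
    rw [Finset.mem_filter, mem_boxes] at hz
    simp only [NE] at hz
    rw [gammaAbove_cons (by simp only; omega)
        (by simp only [vbl, ne_eq, Prod.mk.injEq]; omega)]
    -- An east step at a missing box either overshoots the column of `vbl a` or crosses below the
    -- line `x = y`.
    have : gammaAbove ((x : ℤ) + 1, (y : ℤ)) (vbl a) = 0 := by
      by_cases hxa : x + 1 ≤ a.1 - 1
      · exact gammaAbove_of_lt (by simp only; omega)
      · exact gammaAbove_of_not_le (by simp only [vbl]; omega)
    rw [this, add_zero]
    push_cast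
    rfl
  · unfold NE at h; omega
  · omega
  · unfold NE at h; omega

theorem diagonalSum_self {n x y : ℕ} (hx : x ≤ n) (hxy : x + y = 2 * n) :
    diagonalSum n ((x : ℤ), (y : ℤ)) = 1 := by
  rw [diagonalSum, if_neg (by simp only; omega), Finset.sum_eq_single x]
  · rw [show 2 * (n : ℤ) - (x : ℤ) = y by omega]
    exact gammaAbove_self (by simp only; omega)
  · intro i _ hi
    apply gammaAbove_of_not_le
    simp only
    omega
  · simp only [Finset.mem_range]
    omega

theorem diagonalSum_cons {n x y : ℕ} (hxy : x ≤ y) (h : x + y < 2 * n) :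
    diagonalSum n ((x : ℤ), (y : ℤ)) =
      diagonalSum n ((x : ℤ), (y + 1 : ℤ)) + diagonalSum n ((x + 1 : ℤ), (y : ℤ)) := by
  rw [diagonalSum, if_neg (by simp only; omega), diagonalSum, if_neg (by simp only; omega),
    diagonalSum, if_neg (by simp only; omega), ← Finset.sum_add_distrib]
  refine Finset.sum_congr rfl fun i _ => ?_
  rw [gammaAbove_cons (by simp only; omega) (by simp only [ne_eq, Prod.mk.injEq]; omega)]

/-- Expansion of the diagonal sum along the first corner. -/
theorem diagonalSum_vtr {n : ℕ} {b : ℕ × ℕ} (hb : b.1 ≤ b.2) (hb' : b.1 + b.2 ≤ 2 * n) :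
    diagonalSum n (vtr b) = 1 + ∑ z ∈ boxes n with NE b z, diagonalSum n (vtr z) := by
  -- The columns end on the line `x + y = 2 * n + 1`, one step past the diagonal of endpoints. There
  -- `diagonalSum` is 1 by convention, as if each path were prolonged by a final north step; this
  -- makes boxes with `i + j = 2 * n` possible corners.
  have := eq_one_add_sum_corners (boxes n)
    (fun x y => diagonalSum n ((x : ℤ), (y : ℤ))) n (fun x => 2 * n + 1 - x)
    ?_ ?_ ?_ ?_ ?_ ?_ b.1 (b.2 + 1) ?_ ?_ ?_
  · simp only [vtr]
    push_cast at this
    rw [this]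
    congr 1
  · intro i y hz
    rw [mem_boxes] at hz
    simp only at hz
    omega
  · intro x i y hz
    rw [mem_boxes] at hz ⊢
    simp only at hz ⊢
    omega
  · intro x i y hz
    rw [mem_boxes] at hz
    simp only at hz ⊢
    omega
  · intro x hx hxt
    rw [diagonalSum, if_pos (by simp only; omega)]
  · intro x y hxy hz
    rw [mem_boxes] at hz
    simp only at hz
    simp only [Nat.cast_add, Nat.cast_one]
    exact diagonalSum_cons hxy (by omega)
  · intro x y hx hxy hy hz
    rw [mem_boxes] at hz
    simp only at hz
    simp only [Nat.cast_add, Nat.cast_one]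
    by_cases h : x + y = 2 * n
    · rw [diagonalSum_self hx h, diagonalSum, if_pos (by simp only; omega)]
    · rw [diagonalSum_cons hxy (by omega), add_eq_left, diagonalSum,
        if_neg (by simp only; omega)]
      exact Finset.sum_eq_zero fun i _ => gammaAbove_of_lt (by simp only; omega)
  · omega
  · omega
  · omega

/-! ### Counting chains of boxes -/

/-- The subsets of `S` whose elements are pairwise comparable for `NE`. -/
def chains (S : Finset (ℕ × ℕ)) : Finset (Finset (ℕ × ℕ)) :=
  {A ∈ S.powerset | ∀ a ∈ A, ∀ b ∈ A, a ≠ b → NE a b ∨ NE b a}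

theorem mem_chains {S A : Finset (ℕ × ℕ)} :
    A ∈ chains S ↔ A ⊆ S ∧ ∀ a ∈ A, ∀ b ∈ A, a ≠ b → NE a b ∨ NE b a := by
  simp [chains]

/-- Counting chains according to their least element. -/
theorem card_chains (S : Finset (ℕ × ℕ)) :
    (chains S).card = 1 + ∑ z ∈ S, (chains {y ∈ S | NE z y}).card := by
  have e : chains S = insert ∅ (S.biUnion fun z => (chains {y ∈ S | NE z y}).image (insert z)) := by
    ext A
    simp only [Finset.mem_insert, Finset.mem_biUnion, Finset.mem_image]
    constructor
    · intro hA
      rw [mem_chains] at hA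
      rcases A.eq_empty_or_nonempty with h | h
      · exact Or.inl h
      · right
        obtain ⟨z, hz, hmin⟩ := Finset.exists_min_image A Prod.fst h
        refine ⟨z, hA.1 hz, A.erase z, ?_, Finset.insert_erase hz⟩
        rw [mem_chains]
        constructor
        · intro y hy
          rw [Finset.mem_erase] at hy
          rw [Finset.mem_filter]
          refine ⟨hA.1 hy.2, ?_⟩
          rcases hA.2 y hy.2 z hz hy.1 with h | h
          · have := hmin y hy.2
            have := h.1
            omega
          · exact h
        · intro a ha b hb
          exact hA.2 a (Finset.mem_of_mem_erase ha) b (Finset.mem_of_mem_erase hb)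
    · rintro (rfl | ⟨z, hz, A, hA, rfl⟩)
      · simp [mem_chains]
      · rw [mem_chains] at hA ⊢
        have hA' : ∀ a ∈ A, a ∈ S ∧ NE z a := fun a ha => Finset.mem_filter.1 (hA.1 ha)
        constructor
        · intro a ha
          rcases Finset.mem_insert.1 ha with rfl | ha
          · exact hz
          · exact (hA' a ha).1
        · intro a ha b hb hab
          rcases Finset.mem_insert.1 ha with rfl | ha' <;>
            rcases Finset.mem_insert.1 hb with rfl | hb'
          · exact absurd rfl hab
          · exact Or.inl (hA' b hb').2
          · exact Or.inr (hA' a ha').2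
          · exact hA.2 a ha' b hb' hab
  have hlt : ∀ z, ∀ A ∈ chains {y ∈ S | NE z y}, ∀ a ∈ A, NE z a := by
    intro z A hA a ha
    exact (Finset.mem_filter.1 ((mem_chains.1 hA).1 ha)).2
  have hne : ∀ z, ∀ A ∈ chains {y ∈ S | NE z y}, z ∉ A :=
    fun z A hA h => lt_irrefl _ (hlt z A hA z h).1
  rw [e, Finset.card_insert_of_notMem, Finset.card_biUnion, add_comm]
  · congr 1
    refine Finset.sum_congr rfl fun z _ => Finset.card_image_of_injOn ?_
    intro A hA B hB h
    have h' : insert z A = insert z B := h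
    rw [← Finset.erase_insert (hne z A hA), h', Finset.erase_insert (hne z B hB)]
  · intro x _ y _ hxy
    rw [Function.onFun, Finset.disjoint_left]
    intro C hC hC'
    rw [Finset.mem_image] at hC hC'
    obtain ⟨A, hA, rfl⟩ := hC
    obtain ⟨B, hB, hAB⟩ := hC'
    have h1 : y ∈ insert x A := hAB ▸ Finset.mem_insert_self _ _
    have h2 : x ∈ insert y B := hAB ▸ Finset.mem_insert_self _ _
    have h3 := hlt x A hA y (Finset.mem_of_mem_insert_of_ne h1 (Ne.symm hxy))
    have h4 := hlt y B hB x (Finset.mem_of_mem_insert_of_ne h2 hxy)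
    exact lt_asymm h3.1 h4.1
  · simp

/-- The number of chains in `S` strictly to the north-east of `x`. -/
def numChains (S : Finset (ℕ × ℕ)) (x : ℕ × ℕ) : ℤ := (chains {y ∈ S | NE x y}).card

/-- The recursion of `diagonalSum_vtr`, with `S` in place of all boxes. -/
theorem numChains_eq (S : Finset (ℕ × ℕ)) (x : ℕ × ℕ) :
    numChains S x = 1 + ∑ z ∈ S with NE x z, numChains S z := by
  unfold numChains
  rw [card_chains]
  push_cast
  congr 1
  refine Finset.sum_congr rfl fun z hz => ?_
  rw [Finset.filter_filter]
  congr 3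
  ext y
  simp only [Finset.mem_filter]
  exact ⟨fun h => ⟨h.1, h.2.2⟩, fun h => ⟨h.1, (Finset.mem_filter.1 hz).2.trans h.2, h.2⟩⟩

/-- Decomposition of all paths according to the last forbidden corner. -/
theorem diagonalSum_vtr_eq_numChains {n : ℕ} (N : Finset (ℕ × ℕ)) (hN : N ⊆ boxes n)
    (x : ℕ × ℕ) (hx : x.1 ≤ x.2) (hx' : x.1 + x.2 ≤ 2 * n) :
    diagonalSum n (vtr x) = numChains (boxes n \ N) x +
      ∑ a ∈ N, numChains (boxes n \ N) a * gammaAbove (vtr x) (vbl a) := by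
  obtain ⟨m, hm⟩ : ∃ m, 2 * n - x.2 = m := ⟨_, rfl⟩
  induction m using Nat.strong_induction_on generalizing x with
  | _ m ih =>
  set h := numChains (boxes n \ N) with hh
  have ih' : ∀ z ∈ {z ∈ boxes n | NE x z}, diagonalSum n (vtr z) =
      h z + ∑ a ∈ N, h a * gammaAbove (vtr z) (vbl a) := by
    intro z hz
    rw [Finset.mem_filter, mem_boxes] at hz
    have := hz.2.2
    exact ih _ (by omega) z hz.1.2.1 hz.1.2.2 rfl
  -- First-corner expansion of the path count. The path with no corner contributes the term `h a`;
  -- if `a` is not north-east of `x`, transitivity of `NE` makes everything vanish.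
  have hg : ∀ a ∈ N, h a * gammaAbove (vtr x) (vbl a) = (if NE x a then h a else 0) +
      ∑ z ∈ boxes n with NE x z, h a * gammaAbove (vtr z) (vbl a) := by
    intro a ha
    split_ifs with hxa
    · rw [gammaAbove_vtr_vbl hx (hN ha) hxa, mul_add, mul_one, Finset.mul_sum]
      congr 1
      refine Finset.sum_congr rfl fun z _ => ?_
      split_ifs with hza
      · rfl
      · rw [gammaAbove_vtr_vbl_eq_zero hza]
    · rw [gammaAbove_vtr_vbl_eq_zero hxa, mul_zero, zero_add, Finset.sum_eq_zero]
      intro z hz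
      rw [gammaAbove_vtr_vbl_eq_zero, mul_zero]
      exact fun hza => hxa ((Finset.mem_filter.1 hz).2.trans hza)
  rw [diagonalSum_vtr hx hx', Finset.sum_congr rfl ih', Finset.sum_congr rfl hg,
    Finset.sum_add_distrib, Finset.sum_add_distrib, hh, numChains_eq (boxes n \ N) x, ← hh,
    Finset.sum_comm (s := N), ← Finset.sum_filter, add_assoc, ← add_assoc (Finset.sum _ _)]
  congr 2
  -- The corner-free terms, indexed by `N`, complete the chain recursion over `boxes n \ N` to a sum
  -- over all boxes.
  rw [← Finset.sum_union]
  · refine Finset.sum_congr ?_ fun _ _ => rfl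
    ext z
    simp only [Finset.mem_filter, Finset.mem_union, Finset.mem_sdiff]
    have := @hN z
    tauto
  · rw [Finset.disjoint_left]
    intro z h1 h2
    exact (Finset.mem_sdiff.1 (Finset.mem_filter.1 h1).1).2 (Finset.mem_filter.1 h2).1

/-! ### The determinant -/

/-- Paths from box `b` to box `a` exist only when `a` is in a later column. Sorting by column makes
the matrix block triangular with identity blocks. -/
theorem det_one_add_gammaAbove {k : ℕ} {c : Fin k → ℕ × ℕ} :
    (Matrix.of fun a b => if a = b then 1 else gammaAbove (vtr (c b)) (vbl (c a))).det = 1 := by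
  rw [← Matrix.det_transpose]
  have hb : (Matrix.of fun a b : Fin k => if a = b then (1 : ℤ)
      else gammaAbove (vtr (c b)) (vbl (c a))).transpose.BlockTriangular fun a => (c a).1 := by
    intro a b hab
    simp only [Matrix.transpose_apply, Matrix.of_apply]
    rw [if_neg (by rintro rfl; exact lt_irrefl _ hab), gammaAbove_vtr_vbl_eq_zero]
    exact fun h => lt_asymm h.1 hab
  rw [hb.det]
  refine Finset.prod_eq_one fun m _ => ?_
  rw [show Matrix.toSquareBlock _ _ m = 1 from ?_, Matrix.det_one]
  ext ⟨a, ha⟩ ⟨b, hb⟩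
  simp only [Matrix.toSquareBlock_def, Matrix.of_apply, Matrix.transpose_apply, Matrix.one_apply,
    Subtype.mk.injEq]
  by_cases hab : a = b
  · simp [hab]
  · rw [if_neg (Ne.symm hab), if_neg hab, gammaAbove_vtr_vbl_eq_zero]
    intro h
    have := h.1
    omega

theorem det_cornerMatrix {n k : ℕ} {c : Fin k → ℕ × ℕ} (hc : Function.Injective c)
    (hcd : ∀ l, c l ∈ diagram n) :
    (cornerMatrix n c).det = (chains (boxes n \ Finset.univ.image c)).card := by
  classical
  set S := boxes n \ Finset.univ.image c
  have key : ∀ x : ℕ × ℕ, x.1 ≤ x.2 → x.1 + x.2 ≤ 2 * n → diagonalSum n (vtr x) =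
      numChains S x + ∑ l, numChains S (c l) * gammaAbove (vtr x) (vbl (c l)) := by
    intro x hx hx'
    rw [diagonalSum_vtr_eq_numChains (Finset.univ.image c) _ x hx hx', Finset.sum_image]
    · exact fun a _ b _ h => hc h
    · intro z hz
      obtain ⟨l, -, rfl⟩ := Finset.mem_image.1 hz
      exact mem_boxes_iff.2 (hcd l)
  -- The fictitious box `(0, 0)` has `vtr (0, 0) = (0, 1) = I` and lies south-west of every box, so
  -- the last column obeys the same identity as the others.
  have h0 : numChains S (0, 0) = (chains S).card := by
    unfold numChains
    rw [Finset.filter_true_of_mem]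
    intro y hy
    have := mem_boxes.1 (Finset.mem_sdiff.1 hy).1
    exact ⟨by simp only; omega, by simp only; omega⟩
  -- Row operations that clear the last row.
  let L : Matrix (Fin k ⊕ Unit) (Fin k ⊕ Unit) ℤ :=
    Matrix.fromBlocks 1 0 (Matrix.of fun _ l => -numChains S (c l)) 1
  have hL : L.det = 1 := by simp [L]
  have hmul : L * cornerMatrix n c = Matrix.fromBlocks
      (Matrix.of fun a b => if a = b then 1 else gammaAbove (vtr (c b)) (vbl (c a)))
      (Matrix.of fun a _ => gammaAbove (0, 1) (vbl (c a))) 0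
      (Matrix.of fun _ _ => ((chains S).card : ℤ)) := by
    rw [cornerMatrix, Matrix.fromBlocks_multiply]
    simp only [Matrix.one_mul, Matrix.zero_mul, add_zero]
    congr 1
    · ext u b
      have := key (c b) (hcd b).2.1 (hcd b).2.2
      simp only [Matrix.add_apply, Matrix.mul_apply, Matrix.of_apply, Matrix.zero_apply, this]
      have e : ∀ l, -numChains S (c l) * (if l = b then 1 else gammaAbove (vtr (c b)) (vbl (c l)))
          = -(numChains S (c l) * gammaAbove (vtr (c b)) (vbl (c l)))
            - if l = b then numChains S (c l) else 0 := by
        intro l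
        split_ifs with h
        · subst h
          rw [gammaAbove_vtr_vbl_eq_zero (fun h => lt_irrefl _ h.1)]
          ring
        · ring
      simp only [e, Finset.sum_sub_distrib, Finset.sum_neg_distrib, Finset.sum_ite_eq',
        Finset.mem_univ, if_true]
      ring
    · ext u v
      have := key (0, 0) le_rfl (by simp)
      rw [h0] at this
      simp only [vtr, Nat.cast_zero, zero_add] at this
      simp only [Matrix.add_apply, Matrix.mul_apply, Matrix.of_apply, this, neg_mul,
        Finset.sum_neg_distrib]
      ring
  rw [← one_mul (cornerMatrix n c).det, ← hL, ← Matrix.det_mul, hmul, Matrix.det_fromBlocks_zero₂₁,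
    det_one_add_gammaAbove, one_mul]
  simp

/-! ### Realization of order filters by points of the dominant cone -/

/-- Every order filter of intervals is realized by a decreasing sequence of real numbers. -/
theorem exists_antitone_realization (M : ℕ) (Q : ℕ → ℕ → Prop)
    (hQ : ∀ a b i j, i ≤ a → b ≤ j → Q a b → Q i j) (s : ℕ) :
    ∃ z : ℕ → ℝ, (∀ i j, s ≤ i → i < j → j ≤ M → z j < z i) ∧
      ∀ i j, s ≤ i → i ≤ j → j < M →
        (Q i j → 1 < z i - z (j + 1)) ∧ (¬ Q i j → z i - z (j + 1) < 1) := by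
  classical
  obtain ⟨m, hm⟩ : ∃ m, M - s = m := ⟨_, rfl⟩
  induction m generalizing s with
  | zero => exact ⟨fun _ => 0, fun i j _ _ _ => by omega, fun i j _ _ _ => by omega⟩
  | succ m ih =>
    obtain ⟨z, hz1, hz2⟩ := ih (s + 1) (by omega)
    -- Here `v` is the value at the new left end `s`. The lower bounds lie below the upper ones: if
    -- `Q s j` fails then so does `Q (s + 1) j`, and if moreover `Q s i` holds then `j < i`, whence
    -- `z (i + 1) < z (j + 1)`.
    obtain ⟨v, hv1, hv2⟩ := Order.exists_between_finsets
      (insert (z (s + 1)) ({j ∈ Finset.Ico s M | Q s j}.image fun j => 1 + z (j + 1)))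
      ({j ∈ Finset.Ico s M | ¬ Q s j}.image fun j => 1 + z (j + 1)) (by
        intro x hx y hy
        obtain ⟨j, hj, rfl⟩ := Finset.mem_image.1 hy
        rw [Finset.mem_filter, Finset.mem_Ico] at hj
        rcases Finset.mem_insert.1 hx with rfl | hx
        · rcases hj.1.1.eq_or_lt with rfl | hsj
          · linarith
          · have := (hz2 (s + 1) j le_rfl hsj hj.1.2).2
              (fun h => hj.2 (hQ _ _ _ _ (by omega) le_rfl h))
            linarith
        · obtain ⟨i, hi, rfl⟩ := Finset.mem_image.1 hx
          rw [Finset.mem_filter, Finset.mem_Ico] at hi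
          have hji : j < i := by
            by_contra hij
            exact hj.2 (hQ _ _ _ _ le_rfl (by omega) hi.2)
          have := hz1 (j + 1) (i + 1) (by omega) (by omega) (by omega)
          linarith)
    have hvs : z (s + 1) < v := hv1 _ (Finset.mem_insert_self _ _)
    refine ⟨Function.update z s v, ?_, ?_⟩
    · intro i j hi hij hj
      rw [Function.update_of_ne (by omega : j ≠ s)]
      rcases hi.eq_or_lt with rfl | hi
      · rw [Function.update_self]
        rcases (Nat.succ_le_of_lt hij).eq_or_lt with rfl | h
        · exact hvs
        · exact (hz1 _ _ le_rfl h hj).trans hvs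
      · rw [Function.update_of_ne (by omega)]
        exact hz1 i j hi hij hj
    · intro i j hi hij hj
      rw [Function.update_of_ne (by omega : j + 1 ≠ s)]
      rcases hi.eq_or_lt with rfl | hi
      · rw [Function.update_self]
        constructor
        · intro h
          have := hv1 (1 + z (j + 1)) (Finset.mem_insert_of_mem (Finset.mem_image_of_mem _
            (Finset.mem_filter.2 ⟨Finset.mem_Ico.2 ⟨hij, hj⟩, h⟩)))
          linarith
        · intro h
          have := hv2 (1 + z (j + 1)) (Finset.mem_image_of_mem _
            (Finset.mem_filter.2 ⟨Finset.mem_Ico.2 ⟨hij, hj⟩, h⟩))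
          linarith
      · rw [Function.update_of_ne (by omega)]
        exact hz2 i j hi hij hj

/-- The order on boxes in which larger roots label larger boxes: `a` is below `b` if `b` lies
weakly to the north-west of `a`. -/
def Below (a b : ℕ × ℕ) : Prop := b.1 ≤ a.1 ∧ a.2 ≤ b.2

/-- A symmetric version of `exists_antitone_realization` for order filters of the diagram. -/
theorem exists_symmetric_realization {n M : ℕ} (hM : 2 * n ≤ M) (U : Set (ℕ × ℕ))
    (hU : ∀ a ∈ U, ∀ b ∈ boxes n, Below a b → b ∈ U) (hUb : ∀ a ∈ U, a ∈ boxes n) :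
    ∃ z : ℕ → ℝ, (∀ i, i ≤ M + 1 → z (M + 1 - i) = - z i) ∧
      (∀ i j, 1 ≤ i → i < j → j ≤ M → z j < z i) ∧
      ∀ a ∈ boxes n, (a ∈ U → 1 < z a.1 - z (a.2 + 1)) ∧ (a ∉ U → z a.1 - z (a.2 + 1) < 1) := by
  -- The filter of intervals generated by `U` and by its mirror image under `[i, j] ↦ [M - j, M -
  -- i]`.
  let Q : ℕ → ℕ → Prop := fun i j => ∃ a ∈ U, (i ≤ a.1 ∧ a.2 ≤ j) ∨ (i ≤ M - a.2 ∧ M - a.1 ≤ j)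
  obtain ⟨z, hz1, hz2⟩ := exists_antitone_realization M Q
    (by rintro a b i j h1 h2 ⟨c, hc, h | h⟩
        · exact ⟨c, hc, Or.inl ⟨by omega, by omega⟩⟩
        · exact ⟨c, hc, Or.inr ⟨by omega, by omega⟩⟩) 1
  have hQ1 : ∀ a ∈ boxes n, Q a.1 a.2 ↔ a ∈ U := by
    intro a ha
    constructor
    · rintro ⟨b, hb, h | h⟩
      · exact hU b hb a ha h
      -- Boxes satisfy `i + j ≤ 2 * n ≤ M`, so a box above the mirror image of `b` is also above
      -- `b`; symmetrizing adds no box to `U`.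
      · have hb' := mem_boxes.1 (hUb b hb)
        have ha' := mem_boxes.1 ha
        exact hU b hb a ha ⟨by omega, by omega⟩
    · intro h
      exact ⟨a, h, Or.inl ⟨le_rfl, le_rfl⟩⟩
  have hQ2 : ∀ i j, i ≤ j → j < M → (Q (M - j) (M - i) ↔ Q i j) := by
    intro i j hij hj
    refine exists_congr fun b => and_congr_right fun hb => ?_
    have hb' := mem_boxes.1 (hUb b hb)
    constructor
    · rintro (h | h)
      · right; omega
      · left; omega
    · rintro (h | h)
      · right; omega
      · left; omega
  -- After antisymmetrizing, the difference over an interval is the mean of the differences over it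
  -- and its mirror image, and both lie on the same side of 1.
  refine ⟨fun i => (z i - z (M + 1 - i)) / 2, ?_, ?_, ?_⟩
  · intro i hi
    simp only
    rw [show M + 1 - (M + 1 - i) = i by omega]
    ring
  · intro i j hi hij hj
    have h1 := hz1 i j hi hij hj
    have h2 := hz1 (M + 1 - j) (M + 1 - i) (by omega) (by omega) (by omega)
    simp only
    linarith
  · intro a ha
    have ha' := mem_boxes.1 ha
    have h1 := hz2 a.1 a.2 ha'.1 ha'.2.1 (by omega)
    have h2 := hz2 (M - a.2) (M - a.1) (by omega) (by omega) (by omega)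
    rw [hQ1 a ha] at h1
    rw [hQ2 _ _ ha'.2.1 (by omega), hQ1 a ha, show M - a.1 + 1 = M + 1 - a.1 by omega] at h2
    simp only
    rw [show M + 1 - (a.2 + 1) = M - a.2 by omega]
    constructor
    · intro h
      linarith [h1.1 h, h2.1 h]
    · intro h
      linarith [h1.2 h, h2.2 h]

/-- The vectors `e_1, …, e_n, -e_n, …, -e_1` for `M = 2n`, and
`e_1, …, e_n, 0, -e_n, …, -e_1` for `M = 2n + 1`. -/
def symVec (M n i : ℕ) : EuclideanSpace ℝ (Fin n) := basisVec n i - basisVec n (M + 1 - i)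

theorem basisVec_of_lt {n i : ℕ} (h : n < i) : basisVec n i = 0 := by
  ext m
  have := m.isLt
  simp only [basisVec_apply, PiLp.zero_apply, ite_eq_right_iff]
  omega

theorem boxRootB_eq_symVec {n : ℕ} {c : ℕ × ℕ} (hc : c ∈ boxes n) :
    boxRootB n c = symVec (2 * n + 1) n c.1 - symVec (2 * n + 1) n (c.2 + 1) := by
  have h := mem_boxes.1 hc
  rw [boxRootB_eq (mem_boxes_iff.1 hc), symVec, symVec,
    basisVec_of_lt (i := 2 * n + 1 + 1 - c.1) (by omega)]
  split_ifs with hn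
  · rw [basisVec_of_lt (i := 2 * n + 1 + 1 - (c.2 + 1)) (by omega)]
    abel
  · rw [basisVec_of_lt (i := c.2 + 1) (by omega),
      show 2 * n + 1 + 1 - (c.2 + 1) = 2 * n - c.2 + 1 by omega]
    abel

theorem boxRootC_eq_symVec {n : ℕ} {c : ℕ × ℕ} (hc : c ∈ boxes n) :
    boxRootC n c = symVec (2 * n) n c.1 - symVec (2 * n) n (c.2 + 1) := by
  have h := mem_boxes.1 hc
  rw [boxRootC_eq (mem_boxes_iff.1 hc), symVec, symVec,
    basisVec_of_lt (i := 2 * n + 1 - c.1) (by omega)]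
  split_ifs with hn
  · rw [basisVec_of_lt (i := 2 * n + 1 - (c.2 + 1)) (by omega)]
    abel
  · rw [basisVec_of_lt (i := c.2 + 1) (by omega),
      show 2 * n + 1 - (c.2 + 1) = 2 * n - c.2 by omega]
    abel

theorem symVec_symm {M n i : ℕ} (hi : i ≤ M + 1) : symVec M n (M + 1 - i) = - symVec M n i := by
  rw [symVec, symVec, show M + 1 - (M + 1 - i) = i by omega]
  abel

theorem inner_basisVec {n i : ℕ} (y : EuclideanSpace ℝ (Fin n)) (h : 1 ≤ i ∧ i ≤ n) :
    ⟪basisVec n i, y⟫_ℝ = y ⟨i - 1, by omega⟩ := by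
  have e : basisVec n i = EuclideanSpace.single ⟨i - 1, by omega⟩ (1 : ℝ) := by
    ext m
    simp only [basisVec_apply, PiLp.single_apply, Fin.ext_iff]
    congr 1
    simp only [eq_iff_iff]
    omega
  rw [e, EuclideanSpace.inner_single_left]
  simp

theorem exists_inner_symVec_eq {M n : ℕ} (hM : 2 * n ≤ M) (hM' : M ≤ 2 * n + 1) (z : ℕ → ℝ)
    (hz : ∀ i, i ≤ M + 1 → z (M + 1 - i) = - z i) :
    ∃ y : EuclideanSpace ℝ (Fin n), ∀ i, 1 ≤ i → i ≤ M → ⟪symVec M n i, y⟫_ℝ = z i := by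
  refine ⟨WithLp.toLp 2 fun m => z (m + 1), fun i h1 h2 => ?_⟩
  have key : ∀ i, 1 ≤ i → i ≤ n → 
      ⟪symVec M n i, WithLp.toLp 2 fun m : Fin n => z (m + 1)⟫_ℝ = z i := by
    intro i h1 h2
    rw [symVec, basisVec_of_lt (i := M + 1 - i) (by omega), sub_zero, inner_basisVec _ ⟨h1, h2⟩]
    simp only
    rw [Nat.sub_add_cancel h1]
  by_cases h : i ≤ n
  · exact key i h1 h
  · by_cases h' : M + 1 - i ≤ n
    · have := key (M + 1 - i) (by omega) h'
      rw [symVec_symm (by omega), inner_neg_left, hz i (by omega)] at this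
      linarith
    -- Only the fixed index `i = n + 1` with `M = 2 * n + 1` remains; there both sides are 0.
    · have := hz i (by omega)
      rw [show M + 1 - i = i by omega] at this
      rw [symVec, show M + 1 - i = i by omega, sub_self, inner_zero_left]
      linarith

section

variable {n M : ℕ} {P : Set (EuclideanSpace ℝ (Fin n))} {box : ℕ × ℕ → EuclideanSpace ℝ (Fin n)}

theorem exists_mem_dominantCone (hM : 2 * n ≤ M) (hM' : M ≤ 2 * n + 1)
    (hP : box '' boxes n = P)
    (hbox : ∀ c ∈ boxes n, box c = symVec M n c.1 - symVec M n (c.2 + 1))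
    (U : Set (ℕ × ℕ)) (hU : ∀ a ∈ U, ∀ b ∈ boxes n, Below a b → b ∈ U)
    (hUb : ∀ a ∈ U, a ∈ boxes n) :
    ∃ y ∈ dominantCone P, ∀ a ∈ boxes n, (a ∈ U → 1 < ⟪box a, y⟫_ℝ) ∧
      (a ∉ U → ⟪box a, y⟫_ℝ < 1) := by
  obtain ⟨z, hz, hz1, hz2⟩ := exists_symmetric_realization hM U hU hUb
  obtain ⟨y, hy⟩ := exists_inner_symVec_eq hM hM' z hz
  have key : ∀ a ∈ boxes n, ⟪box a, y⟫_ℝ = z a.1 - z (a.2 + 1) := by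
    intro a ha
    have ha' := mem_boxes.1 ha
    rw [hbox a ha, inner_sub_left, hy _ (by omega) (by omega), hy _ (by omega) (by omega)]
  refine ⟨y, ?_, fun a ha => by rw [key a ha]; exact hz2 a ha⟩
  intro α hα
  rw [← hP] at hα
  obtain ⟨a, ha, rfl⟩ := hα
  have ha' := mem_boxes.1 ha
  rw [key a ha]
  linarith [hz1 a.1 (a.2 + 1) (by omega) (by omega) (by omega)]

/-- The simple roots, at the boxes `(i, i)` with `i ≤ n`, make the values on `symVec` decrease over
the first half of the indices; the symmetry `i ↦ M + 1 - i` gives the other half. -/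
theorem inner_le_inner_of_below (hM : 2 * n ≤ M) (hM' : M ≤ 2 * n + 1)
    (hP : box '' boxes n = P)
    (hbox : ∀ c ∈ boxes n, box c = symVec M n c.1 - symVec M n (c.2 + 1))
    {y : EuclideanSpace ℝ (Fin n)} (hy : y ∈ dominantCone P) {a b : ℕ × ℕ}
    (ha : a ∈ boxes n) (hb : b ∈ boxes n) (hab : Below a b) :
    ⟪box a, y⟫_ℝ ≤ ⟪box b, y⟫_ℝ := by
  have h1 : ∀ i, 1 ≤ i → i ≤ n → ⟪symVec M n (i + 1), y⟫_ℝ ≤ ⟪symVec M n i, y⟫_ℝ := by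
    intro i hi hin
    have hi' : (i, i) ∈ boxes n := mem_boxes.2 ⟨hi, le_rfl, by simp only; omega⟩
    have := hy (box (i, i)) (hP ▸ Set.mem_image_of_mem _ hi')
    rw [hbox _ hi', inner_sub_left] at this
    linarith
  have h2 : ∀ i, 1 ≤ i → i < M → ⟪symVec M n (i + 1), y⟫_ℝ ≤ ⟪symVec M n i, y⟫_ℝ := by
    intro i hi hiM
    by_cases hin : i ≤ n
    · exact h1 i hi hin
    · have := h1 (M - i) (by omega) (by omega)
      rw [show M - i + 1 = M + 1 - i by omega, show M - i = M + 1 - (i + 1) by omega,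
        symVec_symm (by omega), symVec_symm (by omega), inner_neg_left, inner_neg_left] at this
      linarith
  have h3 : ∀ i j, 1 ≤ i → i ≤ j → j ≤ M → ⟪symVec M n j, y⟫_ℝ ≤ ⟪symVec M n i, y⟫_ℝ := by
    intro i j hi hij hj
    induction j, hij using Nat.le_induction with
    | base => exact le_rfl
    | succ j hij ih => exact (h2 j (by omega) (by omega)).trans (ih (by omega))
  have ha' := mem_boxes.1 ha
  have hb' := mem_boxes.1 hb
  rw [hbox a ha, hbox b hb, inner_sub_left, inner_sub_left]
  have e1 := h3 b.1 a.1 hb'.1 hab.1 (by omega)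
  have e2 := h3 (a.2 + 1) (b.2 + 1) (by omega) (by have := hab.2; omega) (by omega)
  linarith

end

/-! ### Regions and sign vectors -/

section

variable {V : Type*} [NormedAddCommGroup V] [InnerProductSpace ℝ V]

theorem pos_side_iff_of_mem_connectedComponentIn {E : Set V} {α x y : V} {r : ℝ}
    (hE : ∀ v ∈ E, ⟪α, v⟫_ℝ ≠ r) (hx : x ∈ E) (hy : y ∈ connectedComponentIn E x) :
    r < ⟪α, x⟫_ℝ ↔ r < ⟪α, y⟫_ℝ := by
  have hpre : IsPreconnected (connectedComponentIn E x) := isPreconnected_connectedComponentIn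
  have hxx : x ∈ connectedComponentIn E x := mem_connectedComponentIn hx
  have hc : ContinuousOn (fun v => ⟪α, v⟫_ℝ) (connectedComponentIn E x) := by fun_prop
  have hno : ∀ v ∈ connectedComponentIn E x, ⟪α, v⟫_ℝ ≠ r :=
    fun v hv => hE v (connectedComponentIn_subset _ _ hv)
  constructor <;> intro h <;> by_contra h'
  · obtain ⟨v, hv, hvr⟩ := hpre.intermediate_value hy hxx hc ⟨not_lt.1 h', h.le⟩
    exact hno v hv hvr
  · obtain ⟨v, hv, hvr⟩ := hpre.intermediate_value hxx hy hc ⟨not_lt.1 h', h.le⟩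
    exact hno v hv hvr

/-- Two points lie in the same region if and only if no hyperplane separates them. -/
theorem connectedComponentIn_shiComplement_eq_iff {P : Set V} {x y : V} (hx : x ∈ shiComplement P)
    (hy : y ∈ shiComplement P) :
    connectedComponentIn (shiComplement P) x = connectedComponentIn (shiComplement P) y ↔
      ∀ α ∈ P, (0 < ⟪α, x⟫_ℝ ↔ 0 < ⟪α, y⟫_ℝ) ∧ (1 < ⟪α, x⟫_ℝ ↔ 1 < ⟪α, y⟫_ℝ) := by
  constructor
  · intro h α hα
    have hy' : y ∈ connectedComponentIn (shiComplement P) x := h ▸ mem_connectedComponentIn hy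
    exact ⟨pos_side_iff_of_mem_connectedComponentIn (fun v hv => (hv α hα).1) hx hy',
      pos_side_iff_of_mem_connectedComponentIn (fun v hv => (hv α hα).2) hx hy'⟩
  · intro h
    -- A convex combination of two numbers on the same side of `r` stays there, so the segment from
    -- `x` to `y` avoids all hyperplanes.
    have aux : ∀ p q r a b : ℝ, p ≠ r → q ≠ r → (r < p ↔ r < q) → 0 ≤ a → 0 ≤ b → a + b = 1 →
        a * p + b * q ≠ r := by
      intro p q r a b hp hq hpq ha hb hab heq
      have e : a * (p - r) + b * (q - r) = 0 := by linear_combination heq - r * hab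
      have key : ∀ s t : ℝ, 0 < s → 0 < t → a * s + b * t ≠ 0 := by
        intro s t hs ht h0
        have h1 := mul_nonneg ha hs.le
        have h2 := mul_nonneg hb ht.le
        have h3 : a = 0 := (mul_eq_zero.1 (by linarith)).resolve_right hs.ne'
        have h4 : b = 0 := (mul_eq_zero.1 (by linarith)).resolve_right ht.ne'
        linarith
      rcases lt_or_gt_of_ne hp with h1 | h1
      · have h2 : q < r := lt_of_le_of_ne (not_lt.1 fun h => lt_asymm h1 (hpq.2 h)) hq
        exact key (r - p) (r - q) (by linarith) (by linarith) (by linarith)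
      · exact key _ _ (sub_pos.2 h1) (sub_pos.2 (hpq.1 h1)) e
    refine connectedComponentIn_eq ((convex_segment x y).isPreconnected.subset_connectedComponentIn
      (left_mem_segment ℝ x y) ?_ (right_mem_segment ℝ x y))
    rintro v ⟨a, b, ha, hb, hab, rfl⟩ α hα
    rw [inner_add_right, inner_smul_right, inner_smul_right]
    exact ⟨aux _ _ _ _ _ (hx α hα).1 (hy α hα).1 (h α hα).1 ha hb hab,
      aux _ _ _ _ _ (hx α hα).2 (hy α hα).2 (h α hα).2 ha hb hab⟩

/-- The number of regions in a Weyl cone is the number of chains of boxes (that is, antichains of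
roots) which avoid the inversion set. -/
theorem numRegions_eq_card_chains [FiniteDimensional ℝ V] {n : ℕ} {P : Set V} {box : ℕ × ℕ → V}
    {w : V ≃ₗᵢ[ℝ] V} {N : Finset (ℕ × ℕ)} (hP : box '' boxes n = P)
    (hmono : ∀ y ∈ dominantCone P, ∀ a ∈ boxes n, ∀ b ∈ boxes n, Below a b →
      ⟪box a, y⟫_ℝ ≤ ⟪box b, y⟫_ℝ)
    (hreal : ∀ U : Set (ℕ × ℕ), (∀ a ∈ U, ∀ b ∈ boxes n, Below a b → b ∈ U) →
      (∀ a ∈ U, a ∈ boxes n) → ∃ y ∈ dominantCone P, ∀ a ∈ boxes n,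
        (a ∈ U → 1 < ⟪box a, y⟫_ℝ) ∧ (a ∉ U → ⟪box a, y⟫_ℝ < 1))
    (hw : ∀ α ∈ P, ∃ β ∈ P, w β = α ∨ w β = -α)
    (hN : ∀ a ∈ boxes n, a ∈ N → -w (box a) ∈ P)
    (hN' : ∀ a ∈ boxes n, a ∉ N → w (box a) ∈ P) :
    numRegions P w = (chains (boxes n \ N)).card := by
  classical
  have hboxP : ∀ a ∈ boxes n, box a ∈ P := fun a ha => hP ▸ Set.mem_image_of_mem _ ha
  have hS : ∀ a ∈ boxes n \ N, a ∈ boxes n ∧ w (box a) ∈ P := fun a ha =>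
    ⟨(Finset.mem_sdiff.1 ha).1, hN' a (Finset.mem_sdiff.1 ha).1 (Finset.mem_sdiff.1 ha).2⟩
  -- every root is, up to sign, the image of a root
  have hcases : ∀ α ∈ P, (∃ a ∈ boxes n \ N, w (box a) = α) ∨ ∃ β ∈ P, w β = -α := by
    intro α hα
    obtain ⟨β, hβ, h | h⟩ := hw α hα
    · rw [← hP] at hβ
      obtain ⟨a, ha, rfl⟩ := hβ
      by_cases haN : a ∈ N
      -- Otherwise `α` and `-α` would both be positive on the nonempty dominant cone.
      · exfalso
        obtain ⟨y, hy, -⟩ := hreal ∅ (by simp) (by simp)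
        have h1 := hy _ hα
        have h2 := hy _ (hN a ha haN)
        rw [h, inner_neg_left] at h2
        linarith
      · exact Or.inl ⟨a, Finset.mem_sdiff.2 ⟨ha, haN⟩, h⟩
    · exact Or.inr ⟨β, hβ, h⟩
  have hneg : ∀ y ∈ dominantCone P, ∀ α ∈ P, (∃ β ∈ P, w β = -α) → ⟪α, w y⟫_ℝ < 0 := by
    rintro y hy α hα ⟨β, hβ, h⟩
    have h1 := hy β hβ
    rw [← w.inner_map_map, h, inner_neg_left] at h1
    linarith
  have hmem : ∀ y ∈ dominantCone P, w y ∈ shiComplement P ↔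
      ∀ a ∈ boxes n \ N, ⟪box a, y⟫_ℝ ≠ 1 := by
    intro y hy
    constructor
    · intro h a ha
      rw [← w.inner_map_map]
      exact (h _ (hS a ha).2).2
    · intro h α hα
      rcases hcases α hα with ⟨a, ha, rfl⟩ | hβ
      · rw [w.inner_map_map]
        exact ⟨(hy _ (hboxP a (hS a ha).1)).ne', h a ha⟩
      · have := hneg y hy α hα hβ
        exact ⟨this.ne, by linarith⟩
  have heq : ∀ y ∈ dominantCone P, ∀ y' ∈ dominantCone P, w y ∈ shiComplement P →
      w y' ∈ shiComplement P → (connectedComponentIn (shiComplement P) (w y) =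
        connectedComponentIn (shiComplement P) (w y') ↔
        ∀ a ∈ boxes n \ N, (1 < ⟪box a, y⟫_ℝ ↔ 1 < ⟪box a, y'⟫_ℝ)) := by
    intro y hy y' hy' h h'
    rw [connectedComponentIn_shiComplement_eq_iff h h']
    constructor
    · intro H a ha
      have := (H _ (hS a ha).2).2
      rwa [w.inner_map_map, w.inner_map_map] at this
    · intro H α hα
      rcases hcases α hα with ⟨a, ha, rfl⟩ | hβ
      · rw [w.inner_map_map, w.inner_map_map]
        have h1 := hy _ (hboxP a (hS a ha).1)
        have h2 := hy' _ (hboxP a (hS a ha).1)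
        exact ⟨by simp [h1, h2], H a ha⟩
      · have h1 := hneg y hy α hα hβ
        have h2 := hneg y' hy' α hα hβ
        exact ⟨⟨fun _ => by linarith, fun _ => by linarith⟩,
          ⟨fun _ => by linarith, fun _ => by linarith⟩⟩
  have hcone : ∀ y ∈ dominantCone P, w y ∈ shiComplement P →
      connectedComponentIn (shiComplement P) (w y) ⊆ weylCone P w := by
    intro y hy hyE x hx
    refine ⟨w.symm x, ?_, w.apply_symm_apply x⟩
    intro β hβ
    have hxE := connectedComponentIn_subset _ _ hx
    have hyx := (connectedComponentIn_shiComplement_eq_iff hyE hxE).1 (connectedComponentIn_eq hx)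
    have e : ⟪β, w.symm x⟫_ℝ = ⟪w β, x⟫_ℝ := by
      rw [← w.inner_map_map, w.apply_symm_apply]
    have h0 := hy β hβ
    rw [← w.inner_map_map] at h0
    rw [e]
    rw [← hP] at hβ
    obtain ⟨a, ha, rfl⟩ := hβ
    by_cases haN : a ∈ N
    · have h1 := hN a ha haN
      have h2 := (hxE _ h1).1
      have h3 := (hyx _ h1).1
      rw [inner_neg_left, inner_neg_left] at h3
      rw [inner_neg_left, neg_ne_zero] at h2
      by_contra h
      have := h3.2 (by have := lt_of_le_of_ne (not_lt.1 h) h2; linarith)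
      linarith
    · exact (hyx _ (hN' a ha haN)).1.1 h0
  -- The filter is generated among all boxes, including those of `N`, because realizability is known
  -- for filters of the whole diagram.
  let U : Finset (ℕ × ℕ) → Set (ℕ × ℕ) := fun A => {b | b ∈ boxes n ∧ ∃ a ∈ A, Below a b}
  have hU : ∀ A, ∃ y ∈ dominantCone P, ∀ a ∈ boxes n,
      (a ∈ U A → 1 < ⟪box a, y⟫_ℝ) ∧ (a ∉ U A → ⟪box a, y⟫_ℝ < 1) := by
    intro A
    refine hreal (U A) ?_ fun a ha => ha.1
    rintro a ⟨-, c, hc, hca⟩ b hb hab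
    exact ⟨hb, c, hc, hab.1.trans hca.1, hca.2.trans hab.2⟩
  choose y hyC hy using hU
  have hyE : ∀ A, w (y A) ∈ shiComplement P := by
    intro A
    rw [hmem _ (hyC A)]
    intro a ha
    by_cases h : a ∈ U A
    · exact ((hy A a (hS a ha).1).1 h).ne'
    · exact ((hy A a (hS a ha).1).2 h).ne
  have hyU : ∀ A, ∀ a ∈ boxes n, 1 < ⟪box a, y A⟫_ℝ ↔ a ∈ U A := by
    intro A a ha
    constructor
    · intro h
      by_contra h'
      exact lt_asymm h ((hy A a ha).2 h')
    · exact (hy A a ha).1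
  have hset : {R | R ∈ shiRegions P ∧ R ⊆ weylCone P w} =
      (fun A => connectedComponentIn (shiComplement P) (w (y A))) ''
        (chains (boxes n \ N) : Set (Finset (ℕ × ℕ))) := by
    ext R
    constructor
    · rintro ⟨⟨x, hx, rfl⟩, hR⟩
      obtain ⟨v, hv, rfl⟩ := hR (mem_connectedComponentIn hx)
      let J := {a ∈ boxes n \ N | 1 < ⟪box a, v⟫_ℝ}
      -- The minimal elements of the admissible roots exceeding 1 at `v`.
      let A := {a ∈ J | ∀ b ∈ J, Below b a → b = a}
      have hJ : ∀ a, a ∈ J ↔ a ∈ boxes n \ N ∧ 1 < ⟪box a, v⟫_ℝ := fun a => Finset.mem_filter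
      have hA : ∀ a, a ∈ A ↔ a ∈ J ∧ ∀ b ∈ J, Below b a → b = a := fun a => Finset.mem_filter
      refine ⟨A, ?_, ?_⟩
      · rw [Finset.mem_coe, mem_chains]
        refine ⟨fun a ha => ((hJ a).1 ((hA a).1 ha).1).1, fun a ha b hb hab => ?_⟩
        -- Two boxes incomparable for `Below` differ strictly in both coordinates in the same
        -- direction, hence are comparable for `NE`.
        have h1 : ¬ Below b a := fun h => hab (((hA a).1 ha).2 b ((hA b).1 hb).1 h).symm
        have h2 : ¬ Below a b := fun h => hab (((hA b).1 hb).2 a ((hA a).1 ha).1 h)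
        unfold Below at h1 h2
        unfold NE
        omega
      · refine (heq _ (hyC A) _ hv (hyE A) hx).2 fun a ha => ?_
        rw [hyU A a (hS a ha).1]
        constructor
        · rintro ⟨-, b, hb, hba⟩
          have hb' := (hJ b).1 ((hA b).1 hb).1
          exact hb'.2.trans_le (hmono v hv b (hS b hb'.1).1 a (hS a ha).1 hba)
        · intro h
          -- The weight drops strictly when passing to a strictly smaller box, so a minimizer below
          -- `a` is a minimal element of `J`.
          obtain ⟨b, hb, hmin⟩ := Finset.exists_min_image {b ∈ J | Below b a}
            (fun b => b.2 + (2 * n - b.1))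
            ⟨a, Finset.mem_filter.2 ⟨(hJ a).2 ⟨ha, h⟩, le_rfl, le_rfl⟩⟩
          rw [Finset.mem_filter] at hb
          refine ⟨(hS a ha).1, b, (hA b).2 ⟨hb.1, fun c hc hcb => ?_⟩, hb.2⟩
          have h1 := hmin c (Finset.mem_filter.2 ⟨hc, hb.2.1.trans hcb.1, hcb.2.trans hb.2.2⟩)
          have h2 := mem_boxes.1 (hS c ((hJ c).1 hc).1).1
          obtain ⟨h3, h4⟩ := hcb
          exact Prod.ext (by omega) (by omega)
    · rintro ⟨A, -, rfl⟩
      exact ⟨⟨_, hyE A, rfl⟩, hcone _ (hyC A) (hyE A)⟩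
  have hinj : Set.InjOn (fun A => connectedComponentIn (shiComplement P) (w (y A)))
      (chains (boxes n \ N) : Set (Finset (ℕ × ℕ))) := by
    -- An antichain is recovered from its filter: `a` lies above some `b ∈ B`, which lies above some
    -- `c ∈ A`, forcing `c = a = b`.
    have key : ∀ A ∈ chains (boxes n \ N), ∀ B ∈ chains (boxes n \ N),
        (∀ a ∈ boxes n \ N, a ∈ U A ↔ a ∈ U B) → A ⊆ B := by
      intro A hA B hB h a ha
      rw [mem_chains] at hA hB
      have haS := hA.1 ha
      obtain ⟨-, b, hb, hba⟩ := (h a haS).1 ⟨(hS a haS).1, a, ha, le_rfl, le_rfl⟩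
      have hbS := hB.1 hb
      obtain ⟨-, c, hc, hcb⟩ := (h b hbS).2 ⟨(hS b hbS).1, b, hb, le_rfl, le_rfl⟩
      obtain ⟨h1, h2⟩ := hba
      obtain ⟨h3, h4⟩ := hcb
      by_cases hca : c = a
      · subst hca
        rwa [show c = b from Prod.ext (by omega) (by omega)]
      · rcases hA.2 c hc a ha hca with h | h
        · have := h.1
          omega
        · have := h.2
          omega
    intro A hA B hB h
    have h' := (heq _ (hyC A) _ (hyC B) (hyE A) (hyE B)).1 h
    have h'' : ∀ a ∈ boxes n \ N, a ∈ U A ↔ a ∈ U B := fun a ha => by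
      rw [← hyU A a (hS a ha).1, ← hyU B a (hS a ha).1]
      exact h' a ha
    exact (key A hA B hB h'').antisymm (key B hB A hA fun a ha => (h'' a ha).symm)
  rw [numRegions, hset, hinj.ncard_image, Set.ncard_coe_finset]

end

/-! ### The Weyl group acts by signed permutations -/

/-- The vectors `±e_i` for `1 ≤ i ≤ n`. -/
def signedBasis (n : ℕ) : Set (EuclideanSpace ℝ (Fin n)) :=
  {v | ∃ i, 1 ≤ i ∧ i ≤ n ∧ (v = basisVec n i ∨ v = -basisVec n i)}

/-- The roots `r e_i` and `e_i ± e_j`: type `B_n` for `r = 1` and type `C_n` for `r = 2`. -/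
def posRoots (r : ℝ) (n : ℕ) : Set (EuclideanSpace ℝ (Fin n)) :=
  {v | (∃ i, 1 ≤ i ∧ i ≤ n ∧ v = r • basisVec n i) ∨
    ∃ i j, 1 ≤ i ∧ i < j ∧ j ≤ n ∧
      (v = basisVec n i - basisVec n j ∨ v = basisVec n i + basisVec n j)}

theorem posRootsB_eq (n : ℕ) : posRootsB n = posRoots 1 n := by
  simp [posRootsB, posRoots]

theorem neg_mem_signedBasis {n : ℕ} {v : EuclideanSpace ℝ (Fin n)} (hv : v ∈ signedBasis n) :
    -v ∈ signedBasis n := by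
  obtain ⟨i, h1, h2, rfl | rfl⟩ := hv
  · exact ⟨i, h1, h2, Or.inr rfl⟩
  · exact ⟨i, h1, h2, Or.inl (neg_neg _)⟩

theorem inner_basisVec_basisVec {n i j : ℕ} (hi : 1 ≤ i ∧ i ≤ n) :
    ⟪basisVec n i, basisVec n j⟫_ℝ = if i = j then 1 else 0 := by
  rw [inner_basisVec _ hi, basisVec_apply]
  simp only
  rw [Nat.sub_add_cancel hi.1]

theorem norm_basisVec {n i : ℕ} (hi : 1 ≤ i ∧ i ≤ n) : ‖basisVec n i‖ = 1 := by
  have := real_inner_self_eq_norm_sq (basisVec n i)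
  rw [inner_basisVec_basisVec hi, if_pos rfl] at this
  nlinarith [norm_nonneg (basisVec n i)]

/-- The reflection in `e_a - u`, where `u = ±e_b`, preserves `±e_1, …, ±e_n`. -/
theorem reflection_sub_mem_signedBasis {n a b : ℕ} (ha : 1 ≤ a ∧ a ≤ n) (hb : 1 ≤ b ∧ b ≤ n)
    {u v : EuclideanSpace ℝ (Fin n)} (hu : u = basisVec n b ∨ u = -basisVec n b)
    (hv : v ∈ signedBasis n) : (ℝ ∙ (basisVec n a - u))ᗮ.reflection v ∈ signedBasis n := by
  have hnorm : ‖basisVec n a‖ = ‖u‖ := by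
    rcases hu with rfl | rfl <;> simp [norm_basisVec ha, norm_basisVec hb]
  have h1 : (ℝ ∙ (basisVec n a - u))ᗮ.reflection (basisVec n a) = u :=
    Submodule.reflection_sub hnorm
  have h2 : (ℝ ∙ (basisVec n a - u))ᗮ.reflection u = basisVec n a := by
    have := Submodule.reflection_reflection (ℝ ∙ (basisVec n a - u))ᗮ (basisVec n a)
    rwa [h1] at this
  have ha' : basisVec n a ∈ signedBasis n := ⟨a, ha.1, ha.2, Or.inl rfl⟩
  have hu' : u ∈ signedBasis n := ⟨b, hb.1, hb.2, hu⟩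
  have key : ∀ i, 1 ≤ i → i ≤ n →
      (ℝ ∙ (basisVec n a - u))ᗮ.reflection (basisVec n i) ∈ signedBasis n := by
    intro i hi1 hi2
    by_cases hia : i = a
    · rw [hia, h1]
      exact hu'
    · by_cases hib : i = b
      · rw [hib]
        rcases hu with rfl | rfl
        · rw [h2]
          exact ha'
        · rw [map_neg, neg_eq_iff_eq_neg] at h2
          rw [h2]
          exact neg_mem_signedBasis ha'
      · rw [Submodule.reflection_mem_subspace_eq_self]
        · exact ⟨i, hi1, hi2, Or.inl rfl⟩
        · rw [Submodule.mem_orthogonal_singleton_iff_inner_right, inner_sub_left,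
            inner_basisVec_basisVec ha, if_neg (Ne.symm hia)]
          rcases hu with rfl | rfl
          · rw [inner_basisVec_basisVec hb, if_neg (Ne.symm hib), sub_zero]
          · rw [inner_neg_left, inner_basisVec_basisVec hb, if_neg (Ne.symm hib), neg_zero,
              sub_zero]
  obtain ⟨i, hi1, hi2, rfl | rfl⟩ := hv
  · exact key i hi1 hi2
  · rw [map_neg]
    exact neg_mem_signedBasis (key i hi1 hi2)

theorem reflection_mem_signedBasis {r : ℝ} (hr : r ≠ 0) {n : ℕ} {α v : EuclideanSpace ℝ (Fin n)}
    (hα : α ∈ posRoots r n) (hv : v ∈ signedBasis n) :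
    (ℝ ∙ α)ᗮ.reflection v ∈ signedBasis n := by
  rcases hα with ⟨a, h1, h2, rfl⟩ | ⟨a, b, h1, h2, h3, rfl | rfl⟩
  · have e : (ℝ ∙ (r • basisVec n a)) = (ℝ ∙ (basisVec n a - -basisVec n a)) := by
      rw [sub_neg_eq_add, ← two_smul ℝ, Submodule.span_singleton_smul_eq hr.isUnit,
        Submodule.span_singleton_smul_eq two_ne_zero.isUnit]
    simp only [e]
    exact reflection_sub_mem_signedBasis ⟨h1, h2⟩ ⟨h1, h2⟩ (Or.inr rfl) hv
  · exact reflection_sub_mem_signedBasis ⟨h1, by omega⟩ ⟨by omega, h3⟩ (Or.inl rfl) hv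
  · rw [← sub_neg_eq_add]
    exact reflection_sub_mem_signedBasis ⟨h1, by omega⟩ ⟨by omega, h3⟩ (Or.inr rfl) hv

theorem weylGroup_apply_mem_signedBasis {r : ℝ} (hr : r ≠ 0) {n : ℕ}
    {w : EuclideanSpace ℝ (Fin n) ≃ₗᵢ[ℝ] EuclideanSpace ℝ (Fin n)}
    (hw : w ∈ weylGroup (posRoots r n)) : ∀ v ∈ signedBasis n, w v ∈ signedBasis n := by
  induction hw using Subgroup.closure_induction'' with
  | mem s hs =>
    obtain ⟨α, hα, rfl⟩ := hs
    exact fun v hv => reflection_mem_signedBasis hr hα hv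
  | inv_mem s hs =>
    obtain ⟨α, hα, rfl⟩ := hs
    rw [Submodule.reflection_inv]
    exact fun v hv => reflection_mem_signedBasis hr hα hv
  | one => exact fun v hv => hv
  | mul x y _ _ hx hy => exact fun v hv => hx _ (hy v hv)

theorem add_mem_posRoots {r : ℝ} {n : ℕ} {u v : EuclideanSpace ℝ (Fin n)}
    (hu : u ∈ signedBasis n) (hv : v ∈ signedBasis n) (huv : ⟪u, v⟫_ℝ = 0) :
    u + v ∈ posRoots r n ∨ -(u + v) ∈ posRoots r n := by
  obtain ⟨i, hi1, hi2, hi⟩ := hu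
  obtain ⟨j, hj1, hj2, hj⟩ := hv
  have hij : i ≠ j := by
    rintro rfl
    have hne : basisVec n i ≠ 0 := by
      rw [← norm_ne_zero_iff, norm_basisVec ⟨hi1, hi2⟩]
      exact one_ne_zero
    rcases hi with rfl | rfl <;> rcases hj with rfl | rfl <;> simp [hne] at huv
  have key : ∀ i j u v, 1 ≤ i → i < j → j ≤ n → (u = basisVec n i ∨ u = -basisVec n i) →
      (v = basisVec n j ∨ v = -basisVec n j) →
      u + v ∈ posRoots r n ∨ -(u + v) ∈ posRoots r n := by
    intro i j u v h1 h2 h3 hu hv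
    rcases hu with rfl | rfl <;> rcases hv with rfl | rfl
    · exact Or.inl (Or.inr ⟨i, j, h1, h2, h3, Or.inr rfl⟩)
    · exact Or.inl (Or.inr ⟨i, j, h1, h2, h3, Or.inl (by abel)⟩)
    · exact Or.inr (Or.inr ⟨i, j, h1, h2, h3, Or.inl (by abel)⟩)
    · exact Or.inr (Or.inr ⟨i, j, h1, h2, h3, Or.inr (by abel)⟩)
  rcases lt_or_gt_of_ne hij with h | h
  · exact key i j u v hi1 h hj2 hi hj
  · rw [add_comm u v]
    exact key j i v u hj1 h hi2 hj hi

/-- A signed permutation sends `e_i`, `e_j` to orthogonal signed basis vectors, which have distinct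
indices, so their sum and difference are again roots up to sign. -/
theorem weylGroup_apply_mem_posRoots {r : ℝ} (hr : r ≠ 0) {n : ℕ}
    {w : EuclideanSpace ℝ (Fin n) ≃ₗᵢ[ℝ] EuclideanSpace ℝ (Fin n)}
    (hw : w ∈ weylGroup (posRoots r n)) {α : EuclideanSpace ℝ (Fin n)} (hα : α ∈ posRoots r n) :
    w α ∈ posRoots r n ∨ -w α ∈ posRoots r n := by
  have hw' := weylGroup_apply_mem_signedBasis hr hw
  have hT : ∀ i, 1 ≤ i → i ≤ n → basisVec n i ∈ signedBasis n :=
    fun i h1 h2 => ⟨i, h1, h2, Or.inl rfl⟩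
  rcases hα with ⟨i, h1, h2, rfl⟩ | ⟨i, j, h1, h2, h3, h⟩
  · obtain ⟨k, hk1, hk2, h | h⟩ := hw' _ (hT i h1 h2)
    · exact Or.inl (Or.inl ⟨k, hk1, hk2, by rw [map_smul, h]⟩)
    · exact Or.inr (Or.inl ⟨k, hk1, hk2, by rw [map_smul, h, smul_neg, neg_neg]⟩)
  · have hi := hw' _ (hT i h1 (by omega))
    have hj := hw' _ (hT j (by omega) h3)
    have h0 : ⟪w (basisVec n i), w (basisVec n j)⟫_ℝ = 0 := by
      rw [w.inner_map_map, inner_basisVec_basisVec ⟨h1, by omega⟩, if_neg (by omega)]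
    rcases h with rfl | rfl
    · rw [map_sub, sub_eq_add_neg]
      exact add_mem_posRoots hi (neg_mem_signedBasis hj) (by rw [inner_neg_right, h0, neg_zero])
    · rw [map_add]
      exact add_mem_posRoots hi hj h0

/-! ### The determinantal formula -/

theorem numRegions_eq_det {r : ℝ} (hr : r ≠ 0) {n M : ℕ} (hM : 2 * n ≤ M) (hM' : M ≤ 2 * n + 1)
    {box : ℕ × ℕ → EuclideanSpace ℝ (Fin n)} (hP : box '' boxes n = posRoots r n)
    (hbox : ∀ c ∈ boxes n, box c = symVec M n c.1 - symVec M n (c.2 + 1))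
    {w : EuclideanSpace ℝ (Fin n) ≃ₗᵢ[ℝ] EuclideanSpace ℝ (Fin n)}
    (hw : w ∈ weylGroup (posRoots r n)) {k : ℕ} {α : Fin k → EuclideanSpace ℝ (Fin n)}
    {c : Fin k → ℕ × ℕ} (hα : Function.Injective α)
    (hrange : Set.range α = inversionSet (posRoots r n) w⁻¹)
    (hc : ∀ l, c l ∈ diagram n ∧ box (c l) = α l) :
    (numRegions (posRoots r n) w : ℤ) = (cornerMatrix n c).det := by
  have hreal := exists_mem_dominantCone hM hM' hP hbox
  -- Realizing the principal filter of `a` separates `box a` from the label of every box not above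
  -- `a`; equal labels therefore force `Below` in both directions.
  have hinj : ∀ a ∈ boxes n, ∀ b ∈ boxes n, box a = box b → a = b := by
    have key : ∀ a ∈ boxes n, ∀ b ∈ boxes n, box a = box b → Below a b := by
      intro a ha b hb hab
      obtain ⟨y, -, hy⟩ := hreal {z | z ∈ boxes n ∧ Below a z}
        (fun z hz z' hz' h => ⟨hz', h.1.trans hz.2.1, hz.2.2.trans h.2⟩) (fun z hz => hz.1)
      by_contra h
      have h1 := (hy a ha).1 ⟨ha, le_rfl, le_rfl⟩
      have h2 := (hy b hb).2 fun hz => h hz.2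
      rw [hab] at h1
      linarith
    intro a ha b hb hab
    obtain ⟨h1, h2⟩ := key a ha b hb hab
    obtain ⟨h3, h4⟩ := key b hb a ha hab.symm
    exact Prod.ext (by omega) (by omega)
  have hcinj : Function.Injective c := fun a b h => hα (by rw [← (hc a).2, ← (hc b).2, h])
  have hmem : ∀ a ∈ boxes n, a ∈ Finset.univ.image c ↔ -w (box a) ∈ posRoots r n := by
    intro a ha
    have h1 : a ∈ Finset.univ.image c ↔ box a ∈ Set.range α := by
      simp only [Finset.mem_image, Finset.mem_univ, true_and, Set.mem_range]
      refine exists_congr fun l => ?_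
      rw [← (hc l).2]
      exact ⟨fun h => by rw [h], fun h => hinj _ (mem_boxes_iff.2 (hc l).1) _ ha h⟩
    rw [h1, hrange]
    constructor
    · rintro ⟨-, β, hβ, h⟩
      have h2 : w (box a) = -β := by
        rw [← h]
        exact w.apply_symm_apply _
      rwa [h2, neg_neg]
    · intro h
      refine ⟨hP ▸ Set.mem_image_of_mem _ ha, _, h, ?_⟩
      rw [neg_neg]
      exact w.symm_apply_apply _
  rw [det_cornerMatrix hcinj fun l => (hc l).1, Nat.cast_inj]
  refine numRegions_eq_card_chains hP
    (fun y hy a ha b hb hab => inner_le_inner_of_below hM hM' hP hbox hy ha hb hab) hreal ?_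
    (fun a ha => (hmem a ha).1) ?_
  · intro β hβ
    have e : w (w⁻¹ β) = β := w.apply_symm_apply β
    rcases weylGroup_apply_mem_posRoots hr (inv_mem hw) hβ with h | h
    · exact ⟨_, h, Or.inl e⟩
    · exact ⟨_, h, Or.inr (by rw [map_neg, e])⟩
  · intro a ha haN
    rw [hmem a ha] at haN
    exact (weylGroup_apply_mem_posRoots hr hw (hP ▸ Set.mem_image_of_mem _ ha)).resolve_right haN

theorem coe_boxes (n : ℕ) : (boxes n : Set (ℕ × ℕ)) = diagram n :=
  Set.ext fun _ => mem_boxes_iff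

end ShiCone
end

theorem mainTheorem3 (n : ℕ) (hn : 1 ≤ n) :
    (∀ w ∈ ShiCone.weylGroup (ShiCone.posRootsB n),
      ∀ (k : ℕ) (α : Fin k → EuclideanSpace ℝ (Fin n)) (c : Fin k → ℕ × ℕ),
        Function.Injective α →
        Set.range α = ShiCone.inversionSet (ShiCone.posRootsB n) w⁻¹ →
        (∀ l, c l ∈ ShiCone.diagram n ∧ ShiCone.boxRootB n (c l) = α l) →
        (ShiCone.numRegions (ShiCone.posRootsB n) w : ℤ) = (ShiCone.cornerMatrix n c).det) ∧
    (∀ w ∈ ShiCone.weylGroup (ShiCone.posRootsC n),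
      ∀ (k : ℕ) (α : Fin k → EuclideanSpace ℝ (Fin n)) (c : Fin k → ℕ × ℕ),
        Function.Injective α →
        Set.range α = ShiCone.inversionSet (ShiCone.posRootsC n) w⁻¹ →
        (∀ l, c l ∈ ShiCone.diagram n ∧ ShiCone.boxRootC n (c l) = α l) →
        (ShiCone.numRegions (ShiCone.posRootsC n) w : ℤ) = (ShiCone.cornerMatrix n c).det) := by
  constructor
  · intro w hw k α c hα hrange hc
    have hP := ShiCone.boxRootB_image n
    rw [← ShiCone.coe_boxes] at hP
    rw [ShiCone.posRootsB_eq] at hw hrange hP ⊢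
    -- In type `B_n` the symmetric sequence needs the middle entry 0, so that `e_n = e_n - 0` is a
    -- difference of neighbours.
    exact ShiCone.numRegions_eq_det one_ne_zero (M := 2 * n + 1) (by omega) le_rfl hP
      (fun _ => ShiCone.boxRootB_eq_symVec) hw hα hrange hc
  · intro w hw k α c hα hrange hc
    have hP := ShiCone.boxRootC_image n
    rw [← ShiCone.coe_boxes] at hP
    -- Without the middle entry, `e_n` and `-e_n` are neighbours and differ by `2 e_n`. `posRootsC
    -- n` is `posRoots 2 n` by definition.
    exact ShiCone.numRegions_eq_det two_ne_zero (M := 2 * n) le_rfl (by omega) hP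
      (fun _ => ShiCone.boxRootC_eq_symVec) hw hα hrange hc
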